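/- All graphs are finite and simple, and a path is always chordless: a path in a graph is a sequence of distinct vertices in which two vertices are adjacent if and only if they are consecutive in the sequence; its length is its number of edges, and a path may consist of a single vertex. A graph $H$ is an induced minor of a graph $G$ if a graph isomorphic to $H$ can be obtained from $G$ by repeatedly deleting vertices and contracting edges. $K_{3,4}$ is the complete bipartite graph with sides of size $3$ and $4$. A theta is a graph made of three internally vertex-disjoint paths $P_1,P_2,P_3$ with the same two ends $a,b$, each of length at least two, such that no edges exist between the paths except the three edges incident to $a$ and the three edges incident to $b$. A prism is a graph made of three vertex-disjoint paths $P_i=a_i\dots b_i$ $(i=1,2,3)$ such that $\{a_1,a_2,a_3\}$ and $\{b_1,b_2,b_3\}$ are triangles, no edges exist between the paths except those of the two triangles, and either $P_1,P_2,P_3$ all have length at least one, or one of them has length zero and each of the other two has length at least two. A pyramid is a graph made of three paths $P_i=a\dots b_i$ $(i=1,2,3)$, each of length at least one and two of them of length at least two, vertex-disjoint except at $a$, such that $\{b_1,b_2,b_3\}$ is a triangle and no edges exist between the paths except those of the triangle and the three edges incident to $a$. A 3-path configuration is a graph that is a theta, a prism or a pyramid. Theorem. If a graph $G$ contains $K_{3,4}$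 as an induced minor, then $G$ contains a 3-path configuration as an induced subgraph. -/

import Mathlib

namespace SimpleGraph

universe u v

/-- The graph obtained from `G` by deleting the vertex `w`. -/
def deleteVertex {V : Type u} (G : SimpleGraph V) (w : V) : SimpleGraph {x : V // x ≠ w} :=
  G.comap Subtype.val

/-- The graph obtained from `G` by merging the vertex `w` into the vertex `z`: `w` disappears and
`z` becomes adjacent to all former neighbours of `w`, loops and multiple edges being dropped.
When `z` and `w` are adjacent, this is the contraction of the edge `zw`. -/
def contract {V : Type u} (G : SimpleGraph V) (z w : V) : SimpleGraph {x : V // x ≠ w} where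
  Adj x y := x ≠ y ∧
    (G.Adj x.1 y.1 ∨ (x.1 = z ∧ G.Adj w y.1) ∨ (y.1 = z ∧ G.Adj x.1 w))
  symm := ⟨by
    rintro x y ⟨hne, h | ⟨h₁, h₂⟩ | ⟨h₁, h₂⟩⟩
    · exact ⟨hne.symm, Or.inl h.symm⟩
    · exact ⟨hne.symm, Or.inr (Or.inr ⟨h₁, h₂.symm⟩)⟩
    · exact ⟨hne.symm, Or.inr (Or.inl ⟨h₁, h₂.symm⟩)⟩⟩
  loopless := ⟨fun _ h => h.1 rfl⟩

/-- `IsInducedMinor H G`: a graph isomorphic to `H` can be obtained from `G` by repeatedly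
deleting vertices and contracting edges. -/
inductive IsInducedMinor {W : Type v} (H : SimpleGraph W) :
    ∀ {V : Type u}, SimpleGraph V → Prop
  | of_iso {V : Type u} {G : SimpleGraph V} (e : Nonempty (H ≃g G)) : IsInducedMinor H G
  | of_deleteVertex {V : Type u} {G : SimpleGraph V} (w : V)
      (h : IsInducedMinor H (G.deleteVertex w)) : IsInducedMinor H G
  | of_contract {V : Type u} {G : SimpleGraph V} (z w : V) (hzw : G.Adj z w)
      (h : IsInducedMinor H (G.contract z w)) : IsInducedMinor H G

/-- `G` is a theta: it is made of three internally vertex-disjoint chordless paths from `a` to `b`,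
each of length at least two, and has no other vertices and no other edges. -/
def IsTheta {V : Type u} (G : SimpleGraph V) : Prop :=
  ∃ (a b : V) (P : Fin 3 → G.Walk a b),
    (∀ i, (P i).IsPath ∧ (P i).IsChordless ∧ 2 ≤ (P i).length) ∧
    (∀ i j, i ≠ j → ∀ x, x ∈ (P i).support → x ∈ (P j).support → x = a ∨ x = b) ∧
    (∀ x, ∃ i, x ∈ (P i).support) ∧
    (∀ x y, G.Adj x y → ∃ i, s(x, y) ∈ (P i).edges)

/-- `G` is a prism: it is made of three vertex-disjoint chordless paths, the `i`-th one from `a i`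
to `b i`, such that the three `a i` form a triangle and the three `b i` form a triangle, and has no
other vertices, and no edges other than those of the paths and of the two triangles. Either
all paths have length at least one, or one has length zero and the other two have length at least
two. -/
def IsPrism {V : Type u} (G : SimpleGraph V) : Prop :=
  ∃ (a b : Fin 3 → V) (P : ∀ i, G.Walk (a i) (b i)),
    (∀ i, (P i).IsPath ∧ (P i).IsChordless) ∧
    (∀ i j, i ≠ j → ∀ x, x ∈ (P i).support → x ∉ (P j).support) ∧
    (∀ i j, i ≠ j → G.Adj (a i) (a j)) ∧
    (∀ i j, i ≠ j → G.Adj (b i) (b j)) ∧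
    ((∀ i, 1 ≤ (P i).length) ∨
      (∃ i, (P i).length = 0 ∧ ∀ j, j ≠ i → 2 ≤ (P j).length)) ∧
    (∀ x, ∃ i, x ∈ (P i).support) ∧
    (∀ x y, G.Adj x y → (∃ i, s(x, y) ∈ (P i).edges) ∨
      (∃ i j, x = a i ∧ y = a j) ∨ (∃ i j, x = b i ∧ y = b j))

/-- `G` is a pyramid: it is made of three chordless paths, the `i`-th one from `a` to `b i`, each of
length at least one and two of them of length at least two, vertex-disjoint except at `a`, such
that the three `b i` form a triangle, and has no other vertices, and no edges other than those of
the paths and of the triangle. -/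
def IsPyramid {V : Type u} (G : SimpleGraph V) : Prop :=
  ∃ (a : V) (b : Fin 3 → V) (P : ∀ i, G.Walk a (b i)),
    (∀ i, (P i).IsPath ∧ (P i).IsChordless ∧ 1 ≤ (P i).length) ∧
    (∃ i j, i ≠ j ∧ 2 ≤ (P i).length ∧ 2 ≤ (P j).length) ∧
    (∀ i j, i ≠ j → ∀ x, x ∈ (P i).support → x ∈ (P j).support → x = a) ∧
    (∀ i j, i ≠ j → G.Adj (b i) (b j)) ∧
    (∀ x, ∃ i, x ∈ (P i).support) ∧
    (∀ x y, G.Adj x y → (∃ i, s(x, y) ∈ (P i).edges) ∨ (∃ i j, x = b i ∧ y = b j))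

/-- A 3-path configuration: a theta, a prism or a pyramid. -/
def IsThreePathConfiguration {V : Type u} (G : SimpleGraph V) : Prop :=
  G.IsTheta ∨ G.IsPrism ∨ G.IsPyramid

end SimpleGraph

/-! Call two sets separate if they are disjoint with no edge between them. The engine of the proof
is `hasConfig_or_hasCenter`: two separate connected sets `X`, `X'` are joined by three pairwise
separate connected connectors. After shrinking everything to minimal sets, the part used in `X` is
either three branches meeting in one vertex, a hub, or three branches joined by a triangle
(`hub_or_tri`); the same holds in `X'`. Gluing two hubs gives a theta, a hub and a triangle a
pyramid, two triangles a prism. This fails only when a hub is itself the end of a connector and is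
too close to the other side. Then some connector contains a center: a vertex that forks inside one
of `X`, `X'` towards the other two connectors, and is near the other set.

The rest consists in finding linkages without centers. Take a model of `K_{3,4}` in which the four
sets `B j` have least total size. By `MinModel.small_or_large`, each `B j` is either small, leaving
no room for a fork, or large: minimal connected between two nonadjacent ends, each end being the
only attachment of one `A i`, while the third set `A f` sees both ends; `f` is the kind of `B j`.
Two small sets are linked by `A 0`, `A 1`, `A 2` without center. If two large sets have the same
kind `f`, they and any third large set link the two `A i` with `i ≠ f` (`Model.hasConfig_of_same`).

There remains one small set `S` and three large sets `D i`, of kind `i` for each `i` (`MixedModel`).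
For each pair `i`, `k`, the engine yields a bridge between an end of `D i` and an end of `D k`,
lying in `A k` or in `A i` (`exists_bridge`); this orients the pair. A tournament on three vertices
has a directed path with two edges, and the corresponding bridges complete a theta
(`hasConfig_of_bridges`). -/

namespace SimpleGraph

/-! ### Connected sets, separate sets and minimality -/

variable {V : Type*} {G : SimpleGraph V}

/-- `S` is nonempty and every nonempty subset of `S` closed under adjacency inside `S` is `S`. -/
def Conn (G : SimpleGraph V) (S : Set V) : Prop :=
  S.Nonempty ∧ ∀ T : Set V, (∃ x ∈ S, x ∈ T) →
    (∀ x ∈ S, x ∈ T → ∀ y ∈ S, G.Adj x y → y ∈ T) → S ⊆ T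

/-- There is an edge between `S` and `T`. -/
def Sees (G : SimpleGraph V) (S T : Set V) : Prop := ∃ x ∈ S, ∃ y ∈ T, G.Adj x y

/-- `S` and `T` are disjoint and there is no edge between them. -/
def Anti (G : SimpleGraph V) (S T : Set V) : Prop := ∀ x ∈ S, ∀ y ∈ T, x ≠ y ∧ ¬ G.Adj x y

theorem Anti.symm {S T : Set V} (h : G.Anti S T) : G.Anti T S :=
  fun x hx y hy => ⟨(h y hy x hx).1.symm, fun e => (h y hy x hx).2 e.symm⟩

theorem Anti.mono {S T S' T' : Set V} (h : G.Anti S T) (hS : S' ⊆ S) (hT : T' ⊆ T) :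
    G.Anti S' T' := fun x hx y hy => h x (hS hx) y (hT hy)

theorem Sees.symm {S T : Set V} (h : G.Sees S T) : G.Sees T S := by
  obtain ⟨x, hx, y, hy, e⟩ := h
  exact ⟨y, hy, x, hx, e.symm⟩

theorem Sees.mono {S T S' T' : Set V} (h : G.Sees S T) (hS : S ⊆ S') (hT : T ⊆ T') :
    G.Sees S' T' := by
  obtain ⟨x, hx, y, hy, e⟩ := h
  exact ⟨x, hS hx, y, hT hy, e⟩

theorem anti_union_left {S T U : Set V} : G.Anti (S ∪ T) U ↔ G.Anti S U ∧ G.Anti T U := by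
  simp only [Anti, Set.mem_union]
  grind

theorem anti_union_right {S T U : Set V} : G.Anti U (S ∪ T) ↔ G.Anti U S ∧ G.Anti U T := by
  simp only [Anti, Set.mem_union]
  grind

theorem conn_singleton (v : V) : G.Conn {v} := by
  refine ⟨⟨v, rfl⟩, ?_⟩
  rintro T ⟨x, hx, hT⟩ - y hy
  obtain rfl : x = v := hx
  obtain rfl : y = x := hy
  exact hT

theorem Conn.union {S T : Set V} (hS : G.Conn S) (hT : G.Conn T) (h : G.Sees S T) :
    G.Conn (S ∪ T) := by
  obtain ⟨a, ha, b, hb, e⟩ := h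
  refine ⟨⟨a, Or.inl ha⟩, fun U hU hcl => ?_⟩
  have h1 : (∃ x ∈ S, x ∈ U) → S ⊆ U := fun h =>
    hS.2 U h fun x hx hxU y hy => hcl x (Or.inl hx) hxU y (Or.inl hy)
  have h2 : (∃ x ∈ T, x ∈ U) → T ⊆ U := fun h =>
    hT.2 U h fun x hx hxU y hy => hcl x (Or.inr hx) hxU y (Or.inr hy)
  obtain ⟨x, hx | hx, hxU⟩ := hU
  · have := h1 ⟨x, hx, hxU⟩
    exact Set.union_subset this (h2 ⟨b, hb, hcl a (Or.inl ha) (this ha) b (Or.inr hb) e⟩)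
  · have := h2 ⟨x, hx, hxU⟩
    exact Set.union_subset (h1 ⟨a, ha, hcl b (Or.inr hb) (this hb) a (Or.inl ha) e.symm⟩) this

theorem Conn.union_of_mem {S T : Set V} (hS : G.Conn S) (hT : G.Conn T) {a : V} (ha : a ∈ S)
    (hb : a ∈ T) : G.Conn (S ∪ T) := by
  refine ⟨⟨a, Or.inl ha⟩, fun U hU hcl => ?_⟩
  have h1 : (∃ x ∈ S, x ∈ U) → S ⊆ U := fun h =>
    hS.2 U h fun x hx hxU y hy => hcl x (Or.inl hx) hxU y (Or.inl hy)
  have h2 : (∃ x ∈ T, x ∈ U) → T ⊆ U := fun h =>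
    hT.2 U h fun x hx hxU y hy => hcl x (Or.inr hx) hxU y (Or.inr hy)
  obtain ⟨x, hx | hx, hxU⟩ := hU
  · have := h1 ⟨x, hx, hxU⟩
    exact Set.union_subset this (h2 ⟨a, hb, this ha⟩)
  · have := h2 ⟨x, hx, hxU⟩
    exact Set.union_subset (h1 ⟨a, ha, this hb⟩) this

theorem Conn.cons {S : Set V} (hS : G.Conn S) {v w : V} (hw : w ∈ S) (h : G.Adj v w) :
    G.Conn (insert v S) := by
  rw [← Set.singleton_union]
  exact (conn_singleton v).union hS ⟨v, rfl, w, hw, h⟩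

theorem conn_pair {v w : V} (h : G.Adj v w) : G.Conn {v, w} :=
  (conn_singleton w).cons rfl h

/-- A connected set with a proper nonempty part has an edge leaving the part. -/
theorem Conn.exists_adj {S T : Set V} (hS : G.Conn S) (h1 : ∃ x ∈ S, x ∈ T)
    (h2 : ∃ x ∈ S, x ∉ T) : ∃ x ∈ S, x ∈ T ∧ ∃ y ∈ S, y ∉ T ∧ G.Adj x y := by
  by_contra! h
  obtain ⟨y, hy, hyT⟩ := h2
  exact hyT (hS.2 T h1 (fun x hx hxT y hy e => by_contra fun hyT => h x hx hxT y hy hyT e) hy)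

theorem exists_minimal_subset [Finite V] {P : Set V → Prop} {X : Set V} (hX : P X) :
    ∃ Y ⊆ X, P Y ∧ ∀ Z ⊆ Y, P Z → Z = Y := by
  obtain ⟨Y, hYX, hY⟩ := exists_minimal_le_of_wellFoundedLT P X hX
  exact ⟨Y, hYX, hY.prop, fun Z hZ hPZ => hY.eq_of_subset hPZ hZ⟩

theorem exists_maximal_superset [Finite V] {P : Set V → Prop} {X : Set V} (hX : P X) :
    ∃ Y, X ⊆ Y ∧ P Y ∧ ∀ Z, Y ⊆ Z → P Z → Z = Y := by
  obtain ⟨Y, hYX, hY⟩ := exists_maximal_ge_of_wellFoundedGT P X hX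
  exact ⟨Y, hYX, hY.prop, fun Z hZ hPZ => (hY.eq_of_superset hPZ hZ)⟩

/-- A connected set can lose a vertex other than a prescribed one. -/
theorem Conn.exists_diff_singleton [Finite V] {B : Set V} (hB : G.Conn B) {r : V} (hr : r ∈ B)
    (hne : ∃ x ∈ B, x ≠ r) : ∃ d ∈ B, d ≠ r ∧ G.Conn (B \ {d}) := by
  have h0 : ({r} : Set V) ⊆ B ∧ ({r} : Set V) ≠ B ∧ G.Conn {r} := by
    refine ⟨by simpa using hr, ?_, conn_singleton r⟩
    rintro rfl
    obtain ⟨x, hx, hxr⟩ := hne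
    exact hxr hx
  obtain ⟨Y, hrY, ⟨hYB, hYne, hY⟩, hmax⟩ :=
    exists_maximal_superset (P := fun Y => Y ⊆ B ∧ Y ≠ B ∧ G.Conn Y) h0
  have hrY : r ∈ Y := hrY rfl
  have h2 : ∃ x ∈ B, x ∉ Y := by
    by_contra! h
    exact hYne (hYB.antisymm h)
  obtain ⟨x, hx, hxY, y, hy, hyY, e⟩ := hB.exists_adj ⟨r, hr, hrY⟩ h2
  -- `Y` is a maximal proper connected subset containing `r`, so a single further vertex fills `B`.
  have hins : insert y Y = B := by
    by_contra hne
    have := hmax (insert y Y) (Set.subset_insert _ _)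
      ⟨Set.insert_subset hy hYB, hne, hY.cons hxY e.symm⟩
    exact hyY (this ▸ Set.mem_insert _ _)
  refine ⟨y, hy, fun h => hyY (h ▸ hrY), ?_⟩
  rw [← hins, Set.insert_sdiff_self_of_notMem hyY]
  exact hY

/-- A connected set with at least two vertices has two vertices each of which it can lose. -/
theorem Conn.exists_two [Finite V] {B : Set V} (hB : G.Conn B) (h : ∀ v, B ≠ {v}) :
    ∃ c ∈ B, ∃ d ∈ B, c ≠ d ∧ G.Conn (B \ {c}) ∧ G.Conn (B \ {d}) := by
  have key : ∀ r ∈ B, ∃ x ∈ B, x ≠ r := by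
    intro r hr
    by_contra! hh
    exact h r (Set.eq_singleton_iff_unique_mem.2 ⟨hr, hh⟩)
  obtain ⟨r, hr⟩ := hB.1
  obtain ⟨c, hc, -, hc'⟩ := hB.exists_diff_singleton hr (key r hr)
  obtain ⟨d, hd, hdc, hd'⟩ := hB.exists_diff_singleton hc (key c hc)
  exact ⟨c, hc, d, hd, hdc.symm, hc', hd'⟩

/-- A minimal connected set meeting `P` and `Q` has one vertex in each. -/
theorem Conn.unique_of_minimal [Finite V] {B P Q : Set V} (hB : G.Conn B)
    (hP : ∃ x ∈ B, x ∈ P) (hQ : ∃ x ∈ B, x ∈ Q)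
    (hmin : ∀ Z ⊆ B, G.Conn Z ∧ (∃ x ∈ Z, x ∈ P) ∧ (∃ x ∈ Z, x ∈ Q) → Z = B) :
    ∃ p ∈ B, ∃ q ∈ B, p ∈ P ∧ q ∈ Q ∧ (∀ x ∈ B, x ∈ P → x = p) ∧ (∀ x ∈ B, x ∈ Q → x = q) := by
  obtain ⟨p, hpB, hpP⟩ := hP
  obtain ⟨q, hqB, hqQ⟩ := hQ
  by_cases h1 : ∃ v, B = {v}
  · obtain ⟨v, rfl⟩ := h1
    obtain rfl : p = v := hpB
    obtain rfl : q = p := hqB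
    exact ⟨q, rfl, q, rfl, hpP, hqQ, fun x hx _ => hx, fun x hx _ => hx⟩
  push Not at h1
  obtain ⟨c, hc, d, hd, hcd, hBc, hBd⟩ := hB.exists_two h1
  -- By minimality, deleting a non-cut vertex destroys one of the two contacts, so that vertex is
  -- the only contact with `P` or with `Q`. Two distinct non-cut vertices must serve different sets.
  have key : ∀ c ∈ B, G.Conn (B \ {c}) →
      (∀ x ∈ B, x ∈ P → x = c) ∨ (∀ x ∈ B, x ∈ Q → x = c) := by
    intro c hc hBc
    by_contra! hh
    obtain ⟨⟨x, hx, hxP, hxc⟩, ⟨y, hy, hyQ, hyc⟩⟩ := hh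
    have := hmin (B \ {c}) Set.sdiff_subset
      ⟨hBc, ⟨x, ⟨hx, hxc⟩, hxP⟩, ⟨y, ⟨hy, hyc⟩, hyQ⟩⟩
    exact (this.symm.subset hc).2 rfl
  rcases key c hc hBc with h | h <;> rcases key d hd hBd with h' | h'
  · exact absurd ((h p hpB hpP).symm.trans (h' p hpB hpP)) hcd
  · exact ⟨p, hpB, q, hqB, hpP, hqQ, fun x hx hxP => (h x hx hxP).trans (h p hpB hpP).symm,
      fun x hx hxP => (h' x hx hxP).trans (h' q hqB hqQ).symm⟩
  · exact ⟨p, hpB, q, hqB, hpP, hqQ, fun x hx hxP => (h' x hx hxP).trans (h' p hpB hpP).symm,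
      fun x hx hxP => (h x hx hxP).trans (h q hqB hqQ).symm⟩
  · exact absurd ((h q hqB hqQ).symm.trans (h' q hqB hqQ)) hcd

/-- A minimal connected set containing `c` and `e ≠ c` stays connected without `e`. -/
theorem Conn.diff_of_minimal [Finite V] {B : Set V} (hB : G.Conn B) {c e : V} (hc : c ∈ B)
    (he : e ∈ B) (hce : c ≠ e) (hmin : ∀ Z ⊆ B, G.Conn Z → c ∈ Z → e ∈ Z → Z = B) :
    G.Conn (B \ {e}) := by
  obtain ⟨d, hd, hdc, hBd⟩ := hB.exists_diff_singleton hc ⟨e, he, hce.symm⟩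
  by_cases hde : d = e
  · exact hde ▸ hBd
  · have := hmin (B \ {d}) Set.sdiff_subset hBd ⟨hc, fun h => hdc h.symm⟩
      ⟨he, fun h => hde h.symm⟩
    exact absurd rfl (this.symm.subset hd).2

/-- A chord would give a shortcut. -/
theorem Walk.isChordless_of_length_eq_dist {a b : V} (p : G.Walk a b)
    (hp : p.length = G.dist a b) : p.IsChordless := by
  rw [Walk.isChordless_iff_forall_mem_edges]
  have key : ∀ i j, i < j → j ≤ p.length → G.Adj (p.getVert i) (p.getVert j) →
      s(p.getVert i, p.getVert j) ∈ p.edges := by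
    intro i j hij hj e
    have h1 := G.dist_le ((p.take i).append (Walk.cons e (p.drop j)))
    have h2 : j = i + 1 := by
      simp only [Walk.length_append, Walk.length_cons, Walk.take_length, Walk.drop_length] at h1
      omega
    subst h2
    exact (Walk.mk_mem_edges_iff_exists p).2 ⟨i, by omega, rfl⟩
  intro x y hx hy e
  obtain ⟨i, rfl, hi⟩ := Walk.mem_support_iff_exists_getVert.1 hx
  obtain ⟨j, rfl, hj⟩ := Walk.mem_support_iff_exists_getVert.1 hy
  rcases lt_trichotomy i j with h | h | h
  · exact key i j h hj e
  · subst h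
    exact absurd e (G.irrefl)
  · rw [Sym2.eq_swap]
    exact key j i h hi e.symm

/-- A shortest path of `G.induce F` works: a chord in `G` has both ends in `F`, hence is a chord
there too. -/
theorem Conn.exists_path {F : Set V} (hF : G.Conn F) {a b : V} (ha : a ∈ F) (hb : b ∈ F) :
    ∃ P : G.Walk a b, P.IsPath ∧ P.IsChordless ∧ ∀ x ∈ P.support, x ∈ F := by
  have hreach : ∀ x (hx : x ∈ F), (G.induce F).Reachable ⟨a, ha⟩ ⟨x, hx⟩ := by
    have := hF.2 {x | ∃ hx : x ∈ F, (G.induce F).Reachable ⟨a, ha⟩ ⟨x, hx⟩}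
      ⟨a, ha, ha, Reachable.refl _⟩ (by
        rintro x hx ⟨_, h⟩ y hy e
        exact ⟨hy, h.trans (Adj.reachable (by simpa using e))⟩)
    exact fun x hx => (this hx).2
  obtain ⟨p, hp⟩ := (hreach b hb).exists_walk_length_eq_dist
  have h1 := p.isPath_of_length_eq_dist hp
  have h2 := Walk.isChordless_iff_forall_mem_edges.1 (p.isChordless_of_length_eq_dist hp)
  obtain ⟨P, hP⟩ : ∃ P : G.Walk a b, P = p.map (Embedding.induce F).toHom := ⟨_, rfl⟩
  have hsup : P.support = p.support.map Subtype.val := by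
    rw [hP]; exact Walk.support_map _ _
  have hedg : P.edges = p.edges.map (Sym2.map Subtype.val) := by
    rw [hP]; exact Walk.edges_map _ _
  refine ⟨P, ?_, ?_, ?_⟩
  · rw [Walk.isPath_def, hsup]
    exact h1.support_nodup.map Subtype.val_injective
  · rw [Walk.isChordless_iff_forall_mem_edges]
    intro x y hx hy e
    rw [hsup, List.mem_map] at hx hy
    obtain ⟨x, hx, rfl⟩ := hx
    obtain ⟨y, hy, rfl⟩ := hy
    rw [hedg, List.mem_map]
    exact ⟨s(x, y), h2 hx hy (by simpa using e), rfl⟩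
  · intro x hx
    rw [hsup, List.mem_map] at hx
    obtain ⟨x, -, rfl⟩ := hx
    exact x.2

/-! ### Recognising configurations from connected sets -/

/-- Some induced subgraph of `G` is a 3-path configuration. -/
def HasConfig (G : SimpleGraph V) : Prop := ∃ S : Set V, (G.induce S).IsThreePathConfiguration

theorem Walk.mem_edges_induce {a b : V} (P : G.Walk a b) (S : Set V)
    (h : ∀ x ∈ P.support, x ∈ S) (x y : S) :
    s(x, y) ∈ (P.induce S h).edges ↔ s(x.1, y.1) ∈ P.edges := by
  have h1 : P.edges = (P.induce S h).edges.map (Sym2.map Subtype.val) := by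
    conv_lhs => rw [← P.map_induce h]
    exact Walk.edges_map _ _
  rw [h1, ← Sym2.map_mk, List.mem_map_of_injective (Sym2.map.injective Subtype.val_injective)]

theorem Walk.mem_support_induce {a b : V} (P : G.Walk a b) (S : Set V)
    (h : ∀ x ∈ P.support, x ∈ S) (x : S) :
    x ∈ (P.induce S h).support ↔ x.1 ∈ P.support := by
  simp [Walk.support_induce]

theorem Walk.length_induce {a b : V} (P : G.Walk a b) (S : Set V)
    (h : ∀ x ∈ P.support, x ∈ S) : (P.induce S h).length = P.length := by
  conv_rhs => rw [← P.map_induce h]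
  exact (Walk.length_map _ _).symm

theorem Walk.IsPath.induce {a b : V} {P : G.Walk a b} (hP : P.IsPath) (S : Set V)
    (h : ∀ x ∈ P.support, x ∈ S) : (P.induce S h).IsPath := by
  rw [Walk.isPath_def, Walk.support_induce]
  refine List.Nodup.of_map Subtype.val ?_
  erw [List.attachWith_map_subtype_val]
  exact hP.support_nodup

theorem Walk.IsChordless.induce {a b : V} {P : G.Walk a b} (hP : P.IsChordless) (S : Set V)
    (h : ∀ x ∈ P.support, x ∈ S) : (P.induce S h).IsChordless := by
  rw [Walk.isChordless_iff_forall_mem_edges] at hP ⊢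
  intro x y hx hy e
  rw [Walk.mem_support_induce] at hx hy
  rw [Walk.mem_edges_induce]
  exact hP hx hy (by simpa using e)

theorem Walk.one_le_length {a b : V} (P : G.Walk a b) (h : a ≠ b) : 1 ≤ P.length := by
  rcases Nat.eq_zero_or_pos P.length with h0 | h0
  · exact absurd (Walk.eq_of_length_eq_zero h0) h
  · exact h0

theorem Walk.two_le_length {a b : V} (P : G.Walk a b) (h : a ≠ b) (h' : ¬ G.Adj a b) :
    2 ≤ P.length := by
  rcases (P.one_le_length h).eq_or_lt with h0 | h0
  · exact absurd (Walk.adj_of_length_eq_one h0.symm) h'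
  · exact h0

/-- Here and in the next two lemmas connected sets stand in for paths: chordless paths are chosen
inside them, and the separation of the sets passes to the paths. -/
theorem hasConfig_of_theta {a b : V} {F : Fin 3 → Set V} (hab : a ≠ b) (hadj : ¬ G.Adj a b)
    (hF : ∀ i, G.Conn (F i)) (ha : ∀ i, a ∈ F i) (hb : ∀ i, b ∈ F i)
    (h : ∀ i k, i ≠ k → ∀ x ∈ F i, ∀ y ∈ F k, x ≠ a → x ≠ b → y ≠ a → y ≠ b →
      x ≠ y ∧ ¬ G.Adj x y) : G.HasConfig := by
  choose P hP hPc hPF using fun i => (hF i).exists_path (ha i) (hb i)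
  refine ⟨{x | ∃ i, x ∈ (P i).support}, Or.inl ?_⟩
  have hS : ∀ i, ∀ x ∈ (P i).support, x ∈ {x | ∃ i, x ∈ (P i).support} := fun i x hx => ⟨i, hx⟩
  refine ⟨⟨a, 0, by simp⟩, ⟨b, 0, by simp⟩, fun i => (P i).induce _ (hS i), ?_, ?_, ?_, ?_⟩
  · exact fun i => ⟨(hP i).induce _ _, (hPc i).induce _ _,
      by rw [Walk.length_induce]; exact (P i).two_le_length hab hadj⟩
  · intro i j hij x hx hy
    rw [Walk.mem_support_induce] at hx hy
    by_contra! hh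
    have h1 : x.1 ≠ a := fun e => hh.1 (Subtype.ext e)
    have h2 : x.1 ≠ b := fun e => hh.2 (Subtype.ext e)
    exact (h i j hij x (hPF i x hx) x (hPF j x hy) h1 h2 h1 h2).1 rfl
  · rintro ⟨x, i, hx⟩
    exact ⟨i, by rwa [Walk.mem_support_induce]⟩
  · rintro ⟨x, i, hx⟩ ⟨y, k, hy⟩ e
    have e : G.Adj x y := by simpa using e
    have key : ∀ i, x ∈ (P i).support → y ∈ (P i).support → s(x, y) ∈ (P i).edges :=
      fun i hx hy => (hPc i).mem_edges hx hy e
    simp only [Walk.mem_edges_induce]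
    by_cases hx' : x = a ∨ x = b
    · refine ⟨k, key k ?_ hy⟩
      rcases hx' with rfl | rfl <;> simp
    by_cases hy' : y = a ∨ y = b
    · refine ⟨i, key i hx ?_⟩
      rcases hy' with rfl | rfl <;> simp
    push Not at hx' hy'
    by_cases hik : i = k
    · subst hik
      exact ⟨i, key i hx hy⟩
    · exact absurd e
        (h i k hik x (hPF i x hx) y (hPF k y hy) hx'.1 hx'.2 hy'.1 hy'.2).2

theorem hasConfig_of_pyramid {a : V} {b : Fin 3 → V} {F : Fin 3 → Set V}
    (hab : ∀ i, a ≠ b i) (hadj : ∃ i j, i ≠ j ∧ ¬ G.Adj a (b i) ∧ ¬ G.Adj a (b j))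
    (hbb : ∀ i j, i ≠ j → G.Adj (b i) (b j))
    (hF : ∀ i, G.Conn (F i)) (ha : ∀ i, a ∈ F i) (hb : ∀ i, b i ∈ F i)
    (h : ∀ i k, i ≠ k → ∀ x ∈ F i, ∀ y ∈ F k, x ≠ a → y ≠ a →
      x ≠ y ∧ (G.Adj x y → x = b i ∧ y = b k)) : G.HasConfig := by
  choose P hP hPc hPF using fun i => (hF i).exists_path (ha i) (hb i)
  refine ⟨{x | ∃ i, x ∈ (P i).support}, Or.inr (Or.inr ?_)⟩
  have hS : ∀ i, ∀ x ∈ (P i).support, x ∈ {x | ∃ i, x ∈ (P i).support} := fun i x hx => ⟨i, hx⟩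
  refine ⟨⟨a, 0, by simp⟩, fun i => ⟨b i, i, by simp⟩,
    fun i => (P i).induce _ (hS i), ?_, ?_, ?_, ?_, ?_, ?_⟩
  · exact fun i => ⟨(hP i).induce _ _, (hPc i).induce _ _,
      by rw [Walk.length_induce]; exact (P i).one_le_length (hab i)⟩
  · obtain ⟨i, j, hij, hi, hj⟩ := hadj
    exact ⟨i, j, hij, by rw [Walk.length_induce]; exact (P i).two_le_length (hab i) hi,
      by rw [Walk.length_induce]; exact (P j).two_le_length (hab j) hj⟩
  · intro i j hij x hx hy
    rw [Walk.mem_support_induce] at hx hy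
    by_contra! hh
    have h1 : x.1 ≠ a := fun e => hh (Subtype.ext e)
    exact (h i j hij x (hPF i x hx) x (hPF j x hy) h1 h1).1 rfl
  · intro i j hij
    simpa using hbb i j hij
  · rintro ⟨x, i, hx⟩
    exact ⟨i, by rwa [Walk.mem_support_induce]⟩
  · rintro ⟨x, i, hx⟩ ⟨y, k, hy⟩ e
    have e : G.Adj x y := by simpa using e
    have key : ∀ i, x ∈ (P i).support → y ∈ (P i).support → s(x, y) ∈ (P i).edges :=
      fun i hx hy => (hPc i).mem_edges hx hy e
    simp only [Walk.mem_edges_induce]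
    by_cases hx' : x = a
    · exact Or.inl ⟨k, key k (by simp [hx']) hy⟩
    by_cases hy' : y = a
    · exact Or.inl ⟨i, key i hx (by simp [hy'])⟩
    by_cases hik : i = k
    · subst hik
      exact Or.inl ⟨i, key i hx hy⟩
    · obtain ⟨h1, h2⟩ := (h i k hik x (hPF i x hx) y (hPF k y hy) hx' hy').2 e
      exact Or.inr ⟨i, k, Subtype.ext h1, Subtype.ext h2⟩

theorem hasConfig_of_prism {d d' : Fin 3 → V} {E : Fin 3 → Set V}
    (hd : ∀ i j, i ≠ j → G.Adj (d i) (d j)) (hd' : ∀ i j, i ≠ j → G.Adj (d' i) (d' j))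
    (hE : ∀ i, G.Conn (E i)) (hdE : ∀ i, d i ∈ E i) (hdE' : ∀ i, d' i ∈ E i)
    (hlen : (∀ i, d i ≠ d' i) ∨
      ∃ i, d i = d' i ∧ ∀ k, k ≠ i → d k ≠ d' k ∧ ¬ G.Adj (d k) (d' k))
    (h : ∀ i k, i ≠ k → ∀ x ∈ E i, ∀ y ∈ E k,
      x ≠ y ∧ (G.Adj x y → (x = d i ∧ y = d k) ∨ (x = d' i ∧ y = d' k))) : G.HasConfig := by
  have hex : ∀ i, ∃ P : G.Walk (d i) (d' i), P.IsPath ∧ P.IsChordless ∧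
      (∀ x ∈ P.support, x ∈ E i) ∧ (d i = d' i → P.length = 0) := by
    intro i
    -- For coinciding ends the trivial path is taken, since the degenerate prism needs a path of
    -- length exactly zero.
    by_cases hi : d i = d' i
    · rw [← hi]
      refine ⟨Walk.nil, Walk.IsPath.nil, ?_, ?_, fun _ => rfl⟩
      · rw [Walk.isChordless_iff_forall_mem_edges]
        simp +contextual
      · simpa using hdE i
    · obtain ⟨P, h1, h2, h3⟩ := (hE i).exists_path (hdE i) (hdE' i)
      exact ⟨P, h1, h2, h3, fun e => absurd e hi⟩
  choose P hP hPc hPF hP0 using hex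
  refine ⟨{x | ∃ i, x ∈ (P i).support}, Or.inr (Or.inl ?_)⟩
  have hS : ∀ i, ∀ x ∈ (P i).support, x ∈ {x | ∃ i, x ∈ (P i).support} := fun i x hx => ⟨i, hx⟩
  refine ⟨fun i => ⟨d i, i, by simp⟩, fun i => ⟨d' i, i, by simp⟩,
    fun i => (P i).induce _ (hS i), ?_, ?_, ?_, ?_, ?_, ?_, ?_⟩
  · exact fun i => ⟨(hP i).induce _ _, (hPc i).induce _ _⟩
  · intro i j hij x hx hy
    rw [Walk.mem_support_induce] at hx hy
    exact (h i j hij x (hPF i x hx) x (hPF j x hy)).1 rfl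
  · intro i j hij
    simpa using hd i j hij
  · intro i j hij
    simpa using hd' i j hij
  · simp only [Walk.length_induce]
    rcases hlen with hl | ⟨i, hi, hl⟩
    · exact Or.inl fun i => (P i).one_le_length (hl i)
    · exact Or.inr ⟨i, hP0 i hi, fun k hk => (P k).two_le_length (hl k hk).1 (hl k hk).2⟩
  · rintro ⟨x, i, hx⟩
    exact ⟨i, by rwa [Walk.mem_support_induce]⟩
  · rintro ⟨x, i, hx⟩ ⟨y, k, hy⟩ e
    have e : G.Adj x y := by simpa using e
    simp only [Walk.mem_edges_induce]
    by_cases hik : i = k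
    · subst hik
      exact Or.inl ⟨i, (hPc i).mem_edges hx hy e⟩
    · rcases (h i k hik x (hPF i x hx) y (hPF k y hy)).2 e with ⟨h1, h2⟩ | ⟨h1, h2⟩
      · exact Or.inr (Or.inl ⟨i, k, Subtype.ext h1, Subtype.ext h2⟩)
      · exact Or.inr (Or.inr ⟨i, k, Subtype.ext h1, Subtype.ext h2⟩)

theorem fin3_cases {i j k : Fin 3} (hij : i ≠ j) (hik : i ≠ k) (hjk : j ≠ k) (l : Fin 3) :
    l = i ∨ l = j ∨ l = k := by
  omega

theorem exists_third {i k : Fin 3} (hik : i ≠ k) : ∃ j, i ≠ j ∧ j ≠ k := by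
  revert i k
  decide

theorem exists_fun3 {α : Type*} {i j k : Fin 3} (hij : i ≠ j) (hik : i ≠ k) (hjk : j ≠ k)
    (a b c : α) : ∃ F : Fin 3 → α, F i = a ∧ F j = b ∧ F k = c :=
  ⟨fun l => if l = i then a else if l = j then b else c,
    by simp, by simp [hij.symm], by simp [hik.symm, hjk.symm]⟩

theorem forall3 {i j k : Fin 3} (hij : i ≠ j) (hik : i ≠ k) (hjk : j ≠ k) {p : Fin 3 → Prop}
    (hi : p i) (hj : p j) (hk : p k) (l : Fin 3) : p l := by
  rcases fin3_cases hij hik hjk l with rfl | rfl | rfl <;> assumption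

theorem forall3_pair {i j k : Fin 3} (hij : i ≠ j) (hik : i ≠ k) (hjk : j ≠ k)
    {p : Fin 3 → Fin 3 → Prop} (hs : ∀ a b, p a b → p b a) (h1 : p i j) (h2 : p i k)
    (h3 : p j k) (a b : Fin 3) (hab : a ≠ b) : p a b := by
  rcases fin3_cases hij hik hjk a with rfl | rfl | rfl <;>
    rcases fin3_cases hij hik hjk b with rfl | rfl | rfl <;>
    first
      | assumption
      | exact hs _ _ (by assumption)
      | exact absurd rfl hab

/-! ### Hubs and triangles in a minimal connected set -/

/-- `v` sends two separate connected branches inside `X` to the two members of `C` other than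
the `j`-th one. -/
def Fan (G : SimpleGraph V) (X : Set V) (C : Fin 3 → Set V) (j : Fin 3) (v : V) : Prop :=
  ∃ S : Fin 3 → Set V,
    (∀ i, i ≠ j → S i ⊆ X ∧ G.Conn (S i) ∧ (∃ y ∈ S i, G.Adj v y) ∧ G.Sees (C i) (S i)) ∧
    (∀ i k, i ≠ j → k ≠ j → i ≠ k → G.Anti (S i) (S k) ∧ ¬ G.Sees (C k) (S i))

/-- Three connected sets in `X` plus the terminals, meeting in the single vertex `h`. -/
def IsHub (G : SimpleGraph V) (X : Set V) (t : Fin 3 → V) (h : V) (F : Fin 3 → Set V) : Prop :=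
  (∀ i, G.Conn (F i) ∧ h ∈ F i ∧ t i ∈ F i ∧ F i ⊆ X ∪ {t i, h}) ∧
    ∀ i k, i ≠ k → G.Anti (F i \ {h}) (F k \ {h})

/-- Three connected sets in `X` plus the terminals, joined by the triangle `d`. -/
def IsTri (G : SimpleGraph V) (X : Set V) (t d : Fin 3 → V) (P : Fin 3 → Set V) : Prop :=
  (∀ i, G.Conn (P i) ∧ d i ∈ P i ∧ t i ∈ P i ∧ P i ⊆ X ∪ {t i}) ∧
    (∀ i k, i ≠ k → G.Adj (d i) (d k)) ∧
    ∀ i k, i ≠ k → ∀ x ∈ P i, ∀ y ∈ P k, x ≠ y ∧ (G.Adj x y → x = d i ∧ y = d k)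

/-- If `t` does not see `L`, a component of `X \ L` containing a neighbour of `t` sees `L` because
`X` is connected. A minimal part of it from `t` to `L` meets `L`'s neighbourhood in one vertex. -/
theorem exists_attachment [Finite V] {X L : Set V} (hX : G.Conn X) (hL : L.Nonempty) (hLX : L ⊆ X)
    {t : V} (htX : t ∉ X) (ht : ∃ x ∈ X, G.Adj t x) :
    ∃ M : Set V, ∃ μ ∈ M, G.Conn M ∧ t ∈ M ∧ M ⊆ (X \ L) ∪ {t} ∧ (∃ x ∈ L, G.Adj μ x) ∧
      ∀ y ∈ M, ∀ x ∈ L, G.Adj y x → y = μ := by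
  by_cases h : ∃ x ∈ L, G.Adj t x
  · refine ⟨{t}, t, rfl, conn_singleton t, rfl, by simp, h, fun y hy _ _ _ => hy⟩
  push Not at h
  obtain ⟨x, hx, htx⟩ := ht
  have hxL : x ∉ L := fun hxL => h x hxL htx
  obtain ⟨Y, hxY, ⟨hYX, hYc⟩, hmax⟩ :=
    exists_maximal_superset (P := fun Y => Y ⊆ X \ L ∧ G.Conn Y) (X := {x})
      ⟨by simp [hx, hxL], conn_singleton x⟩
  have hxY : x ∈ Y := hxY rfl
  obtain ⟨l, hl⟩ := hL
  obtain ⟨a, -, haY, b, hb, hbY, e⟩ := hX.exists_adj ⟨x, hx, hxY⟩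
    ⟨l, hLX hl, fun hlY => (hYX hlY).2 hl⟩
  have hbL : b ∈ L := by
    by_contra hbL
    have := hmax (insert b Y) (Set.subset_insert _ _)
      ⟨Set.insert_subset ⟨hb, hbL⟩ hYX, hYc.cons haY e.symm⟩
    exact hbY (this ▸ Set.mem_insert _ _)
  obtain ⟨M, hMY, ⟨hM, hM1, hM2⟩, hmin⟩ := exists_minimal_subset
    (P := fun M => G.Conn M ∧ (∃ x ∈ M, x ∈ {x | G.Adj t x}) ∧
      (∃ x ∈ M, x ∈ {x | ∃ y ∈ L, G.Adj x y})) (X := Y)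
    ⟨hYc, ⟨x, hxY, htx⟩, ⟨a, haY, b, hbL, e⟩⟩
  obtain ⟨p, hp, q, hq, hpt, hqL, -, hq'⟩ := hM.unique_of_minimal hM1 hM2 hmin
  refine ⟨insert t M, q, Or.inr hq, hM.cons hp hpt, Or.inl rfl, ?_, hqL, ?_⟩
  · rw [Set.insert_subset_iff]
    exact ⟨Or.inr rfl, fun y hy => Or.inl (hYX (hMY hy))⟩
  · rintro y (rfl | hy) z hz e
    · exact absurd e (h z hz)
    · exact hq' y hy ⟨z, hz, e⟩

/-- A minimal connected set joining `c` to a neighbour of `m`. -/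
theorem exists_branch [Finite V] {L : Set V} (hL : G.Conn L) {c m : V} (hc : c ∈ L)
    (hm : ∃ x ∈ L, G.Adj m x) :
    ∃ S ⊆ L, ∃ e ∈ S, G.Conn S ∧ c ∈ S ∧ G.Adj m e ∧ (∀ x ∈ S, G.Adj m x → x = e) ∧
      ∀ x ∈ S, x ≠ e → c ∈ S \ {e} ∧ G.Conn (S \ {e}) := by
  obtain ⟨x, hx, hmx⟩ := hm
  obtain ⟨S, hSL, ⟨hS, hS1, hS2⟩, hmin⟩ := exists_minimal_subset
    (P := fun M => G.Conn M ∧ (∃ x ∈ M, x ∈ ({c} : Set V)) ∧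
      (∃ x ∈ M, x ∈ {x | G.Adj m x})) (X := L)
    ⟨hL, ⟨c, hc, rfl⟩, ⟨x, hx, hmx⟩⟩
  obtain ⟨p, hp, e, he, hpc, hme, -, he'⟩ := hS.unique_of_minimal hS1 hS2 hmin
  obtain rfl : p = c := hpc
  refine ⟨S, hSL, e, he, hS, hp, hme, he', fun x hx hxe => ?_⟩
  have hpe : p ≠ e := by
    rintro rfl
    have := hmin {p} (by simpa using hp) ⟨conn_singleton p, ⟨p, rfl, rfl⟩, ⟨p, rfl, hme⟩⟩
    rw [← this] at hx
    exact hxe hx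
  refine ⟨⟨hp, hpe⟩, hS.diff_of_minimal hp he hpe fun Z hZ hZc hpZ heZ => ?_⟩
  exact hmin Z hZ ⟨hZc, ⟨p, hpZ, rfl⟩, ⟨e, heZ, hme⟩⟩

/-- Two non-cut vertices `c`, `d` of `X` are the sole attachments of two connectors. A minimal
connection `L` between them is reached from the third terminal through one vertex `μ`, and the way
`μ` attaches to `L` decides between hub and triangle. -/
theorem hub_or_tri [Finite V] {X : Set V} {C : Fin 3 → Set V} {t : Fin 3 → V} (hX : G.Conn X)
    (hmin : ∀ Z ⊆ X, G.Conn Z → (∀ i, G.Sees (C i) Z) → Z = X)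
    (htC : ∀ i, t i ∈ C i) (ht : ∀ i, ∃ x ∈ X, G.Adj (t i) x)
    (htt : ∀ i k, i ≠ k → t i ≠ t k ∧ ¬ G.Adj (t i) (t k)) (htX : ∀ i, t i ∉ X) :
    (∃ h F, G.IsHub X t h F ∧ (h ∈ X ∨ ∃ j, h = t j ∧ G.Fan X C j (t j))) ∨
      ∃ d P, G.IsTri X t d P := by
  by_cases h1 : ∃ v, X = {v}
  · obtain ⟨v, rfl⟩ := h1
    have hv : ∀ i, G.Adj (t i) v := fun i => by
      obtain ⟨x, hx, e⟩ := ht i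
      obtain rfl : x = v := hx
      exact e
    refine Or.inl ⟨v, fun i => {t i, v}, ⟨fun i => ⟨conn_pair (hv i), Or.inr rfl, Or.inl rfl,
      Set.subset_union_right⟩, ?_⟩, Or.inl rfl⟩
    rintro i k hik x ⟨rfl | hx, hxv⟩ y ⟨rfl | hy, hyv⟩
    · exact htt i k hik
    · exact absurd hy hyv
    · exact absurd hx hxv
    · exact absurd hx hxv
  push Not at h1
  obtain ⟨c, hc, d, hd, hcd, hXc, hXd⟩ := hX.exists_two h1
  -- Minimality of `X` forbids deleting a non-cut vertex `c`, so some `C i` is attached to `X` at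
  -- `c` alone.
  have key : ∀ c ∈ X, G.Conn (X \ {c}) → ∃ i, G.Adj (t i) c ∧
      ∀ y ∈ C i, ∀ x ∈ X, G.Adj y x → x = c := by
    intro c hc hXc
    obtain ⟨i, hi⟩ : ∃ i, ¬ G.Sees (C i) (X \ {c}) := by
      by_contra! hh
      have := hmin _ Set.sdiff_subset hXc hh
      exact (this.symm.subset hc).2 rfl
    have hi' : ∀ y ∈ C i, ∀ x ∈ X, G.Adj y x → x = c := fun y hy x hx e => by
      by_contra hxc
      exact hi ⟨y, hy, x, ⟨hx, hxc⟩, e⟩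
    obtain ⟨x, hx, e⟩ := ht i
    obtain rfl := hi' _ (htC i) x hx e
    exact ⟨i, e, hi'⟩
  obtain ⟨i, hic, hi⟩ := key c hc hXc
  obtain ⟨k, hkd, hk⟩ := key d hd hXd
  have hik : i ≠ k := by
    rintro rfl
    exact hcd (hk _ (htC i) c hc hic)
  obtain ⟨j, hij, hjk⟩ : ∃ j, i ≠ j ∧ j ≠ k := exists_third hik
  obtain ⟨L, hLX, ⟨hL, hcL, hdL⟩, hLmin⟩ := exists_minimal_subset
    (P := fun L => G.Conn L ∧ c ∈ L ∧ d ∈ L) ⟨hX, hc, hd⟩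
  obtain ⟨M, μ, hμM, hM, htM, hMX, hμL, hμ⟩ := exists_attachment hX ⟨c, hcL⟩ hLX (htX j) (ht j)
  have hti : ∀ x ∈ X, G.Adj (t i) x → x = c := hi _ (htC i)
  have htk : ∀ x ∈ X, G.Adj (t k) x → x = d := hk _ (htC k)
  have hML : ∀ x ∈ M, x ∉ L := fun x hx hxL => by
    rcases hMX hx with h | rfl
    · exact h.2 hxL
    · exact htX j (hLX hxL)
  have hM' : M ⊆ X ∪ {t j} := fun x hx => (hMX hx).imp_left And.left
  have htiM : ∀ x ∈ M, x ≠ t i ∧ ¬ G.Adj (t i) x := fun x hx => by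
    rcases hMX hx with h | rfl
    · refine ⟨?_, fun e => ?_⟩
      · rintro rfl
        exact htX i h.1
      · exact h.2 (hti x h.1 e ▸ hcL)
    · exact ⟨(htt i j hij).1.symm, (htt i j hij).2⟩
  have htkM : ∀ x ∈ M, x ≠ t k ∧ ¬ G.Adj (t k) x := fun x hx => by
    rcases hMX hx with h | rfl
    · refine ⟨?_, fun e => ?_⟩
      · rintro rfl
        exact htX k h.1
      · exact h.2 (htk x h.1 e ▸ hdL)
    · exact ⟨(htt j k hjk).1, fun e => (htt j k hjk).2 e.symm⟩
  -- `S` runs inside `L` from `c` to a first neighbour `e` of `μ`, and `T` from `d` to a first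
  -- neighbour `f`. If they are separate, `μ` is a hub.
  obtain ⟨S, hSL, e, heS, hS, hcS, hμe, heu, hSe⟩ := exists_branch hL hcL hμL
  obtain ⟨T, hTL, f, hfT, hT, hdT, hμf, hfu, hTf⟩ := exists_branch hL hdL hμL
  have htiS : t i ∉ S := fun h => htX i (hLX (hSL h))
  have htkT : t k ∉ T := fun h => htX k (hLX (hTL h))
  have htiT : t i ∉ T := fun h => htX i (hLX (hTL h))
  have htkS : t k ∉ S := fun h => htX k (hLX (hSL h))
  by_cases hST : G.Anti S T
  · left
    obtain ⟨F, hFi, hFj, hFk⟩ := exists_fun3 hij hik hjk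
      (insert μ (insert (t i) S)) M (insert μ (insert (t k) T))
    have hFi' : F i \ {μ} ⊆ insert (t i) S := by
      rw [hFi]; rintro x ⟨rfl | hx, hxμ⟩
      · exact absurd rfl hxμ
      · exact hx
    have hFk' : F k \ {μ} ⊆ insert (t k) T := by
      rw [hFk]; rintro x ⟨rfl | hx, hxμ⟩
      · exact absurd rfl hxμ
      · exact hx
    refine ⟨μ, F, ⟨forall3 hij hik hjk ?_ ?_ ?_, forall3_pair hij hik hjk
      (fun a b h => h.symm) ?_ ?_ ?_⟩, ?_⟩
    · rw [hFi]
      refine ⟨(hS.cons hcS hic).cons (Or.inr heS) hμe, Or.inl rfl, Or.inr (Or.inl rfl), ?_⟩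
      rintro x (rfl | rfl | hx)
      · simp
      · simp
      · exact Or.inl (hLX (hSL hx))
    · rw [hFj]
      refine ⟨hM, hμM, htM, fun x hx => ?_⟩
      rcases hM' hx with h | rfl
      · exact Or.inl h
      · simp
    · rw [hFk]
      refine ⟨(hT.cons hdT hkd).cons (Or.inr hfT) hμf, Or.inl rfl, Or.inr (Or.inl rfl), ?_⟩
      rintro x (rfl | rfl | hx)
      · simp
      · simp
      · exact Or.inl (hLX (hTL hx))
    · rw [hFj]
      refine Anti.mono (S := insert (t i) S) ?_ hFi' subset_rfl
      rintro x (rfl | hx) y ⟨hyM, hyμ⟩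
      · exact ⟨(htiM y hyM).1.symm, (htiM y hyM).2⟩
      · refine ⟨?_, fun e => hyμ (hμ y hyM x (hSL hx) e.symm)⟩
        rintro rfl
        exact hML x hyM (hSL hx)
    · refine Anti.mono (S := insert (t i) S) (T := insert (t k) T) ?_ hFi' hFk'
      rintro x (rfl | hx) y (rfl | hy)
      · exact htt i k hik
      · refine ⟨fun h => htiT (h ▸ hy), fun e => ?_⟩
        obtain rfl := hti y (hLX (hTL hy)) e
        exact (hST y hcS y hy).1 rfl
      · refine ⟨fun h => htkS (h ▸ hx), fun e => ?_⟩
        obtain rfl := htk x (hLX (hSL hx)) e.symm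
        exact (hST x hx x hdT).1 rfl
      · exact hST x hx y hy
    · rw [hFj]
      refine Anti.mono (T := insert (t k) T) ?_ subset_rfl hFk'
      rintro y ⟨hyM, hyμ⟩ x (rfl | hx)
      · exact ⟨(htkM y hyM).1, fun e => (htkM y hyM).2 e.symm⟩
      · refine ⟨?_, fun e => hyμ (hμ y hyM x (hTL hx) e)⟩
        rintro rfl
        exact hML y hyM (hTL hx)
    · rcases hM' hμM with h | h
      · exact Or.inl h
      -- The hub lies outside `X`: it is the terminal itself, and `S`, `T` are the branches of its
      -- fan.
      · obtain rfl : μ = t j := h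
        refine Or.inr ⟨j, rfl, ?_⟩
        obtain ⟨R, hRi, -, hRk⟩ := exists_fun3 hij hik hjk S ∅ T
        have hcases : ∀ l, l ≠ j → l = i ∨ l = k := fun l hl => by
          rcases fin3_cases hij hik hjk l with h | h | h <;> tauto
        refine ⟨R, ?_, ?_⟩
        · intro l hl
          rcases hcases l hl with rfl | rfl
          · rw [hRi]
            exact ⟨hSL.trans hLX, hS, ⟨e, heS, hμe⟩, ⟨t l, htC l, c, hcS, hic⟩⟩
          · rw [hRk]
            exact ⟨hTL.trans hLX, hT, ⟨f, hfT, hμf⟩, ⟨t l, htC l, d, hdT, hkd⟩⟩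
        · intro l m hl hm hlm
          rcases hcases l hl with rfl | rfl <;> rcases hcases m hm with rfl | rfl
          · exact absurd rfl hlm
          · rw [hRi, hRk]
            refine ⟨hST, ?_⟩
            rintro ⟨y, hy, x, hx, e⟩
            obtain rfl := hk y hy x (hLX (hSL hx)) e
            exact (hST x hx x hdT).1 rfl
          · rw [hRi, hRk]
            refine ⟨hST.symm, ?_⟩
            rintro ⟨y, hy, x, hx, e⟩
            obtain rfl := hi y hy x (hLX (hTL hx)) e
            exact (hST x hcS x hx).1 rfl
          · exact absurd rfl hlm
  -- Touching parts of `S` and `T` that keep `c` and `d` already cover `L`, by minimality of `L`.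
  -- Hence `S` and `T` can touch only at `e` and `f`: a common vertex `e = f` is a hub, and
  -- otherwise `e`, `μ`, `f` form a triangle.
  have hunion : ∀ S' ⊆ S, ∀ T' ⊆ T, G.Conn S' → G.Conn T' → c ∈ S' → d ∈ T' → ∀ x ∈ S', ∀ y ∈ T',
      (x = y ∨ G.Adj x y) → S' ∪ T' = L := by
    intro S' hS' T' hT' hSc hTc hcS' hdT' x hx y hy hxy
    refine hLmin _ (Set.union_subset (hS'.trans hSL) (hT'.trans hTL))
      ⟨?_, Or.inl hcS', Or.inr hdT'⟩
    rcases hxy with rfl | hxy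
    · exact hSc.union_of_mem hTc hx hy
    · exact hSc.union hTc ⟨x, hx, y, hy, hxy⟩
  obtain ⟨a, ha, b, hb, hab⟩ : ∃ a ∈ S, ∃ b ∈ T, a = b ∨ G.Adj a b := by
    unfold Anti at hST
    push Not at hST
    obtain ⟨a, ha, b, hb, hab⟩ := hST
    exact ⟨a, ha, b, hb, or_iff_not_imp_left.2 hab⟩
  have hSTL : S ∪ T = L := hunion S subset_rfl T subset_rfl hS hT hcS hdT a ha b hb hab
  have hML' : ∀ y ∈ M, ∀ x ∈ L, G.Adj y x → y = μ ∧ ((x ∈ S ∧ x = e) ∨ (x ∈ T ∧ x = f)) := by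
    intro y hy x hx hyx
    obtain rfl := hμ y hy x hx hyx
    rw [← hSTL] at hx
    exact ⟨rfl, hx.imp (fun h => ⟨h, heu x h hyx⟩) (fun h => ⟨h, hfu x h hyx⟩)⟩
  by_cases hef : e = f
  · subst hef
    left
    have hanti : ∀ x ∈ S, x ≠ e → ∀ y ∈ T, y ≠ e → x ≠ y ∧ ¬ G.Adj x y := by
      intro x hx hxe y hy hye
      by_contra hh
      have hh : x = y ∨ G.Adj x y := by tauto
      have := hunion _ Set.sdiff_subset _ Set.sdiff_subset (hSe x hx hxe).2 (hTf y hy hye).2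
        (hSe x hx hxe).1 (hTf y hy hye).1 x ⟨hx, hxe⟩ y ⟨hy, hye⟩ hh
      rcases this.symm.subset (hSL heS) with h | h
      · exact h.2 rfl
      · exact h.2 rfl
    obtain ⟨F, hFi, hFj, hFk⟩ := exists_fun3 hij hik hjk
      (insert (t i) S) (insert e M) (insert (t k) T)
    refine ⟨e, F, ⟨forall3 hij hik hjk ?_ ?_ ?_, forall3_pair hij hik hjk
      (fun a b h => h.symm) ?_ ?_ ?_⟩, Or.inl (hLX (hSL heS))⟩
    · rw [hFi]
      refine ⟨hS.cons hcS hic, Or.inr heS, Or.inl rfl, ?_⟩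
      rintro x (rfl | hx)
      · simp
      · exact Or.inl (hLX (hSL hx))
    · rw [hFj]
      refine ⟨hM.cons hμM hμe.symm, Or.inl rfl, Or.inr htM, ?_⟩
      rintro x (rfl | hx)
      · simp
      · rcases hM' hx with h | rfl
        · exact Or.inl h
        · simp
    · rw [hFk]
      refine ⟨hT.cons hdT hkd, Or.inr hfT, Or.inl rfl, ?_⟩
      rintro x (rfl | hx)
      · simp
      · exact Or.inl (hLX (hTL hx))
    · rw [hFi, hFj]
      rintro x ⟨rfl | hx, hxe⟩ y ⟨rfl | hy, hye⟩
      · exact absurd rfl hye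
      · exact ⟨(htiM y hy).1.symm, (htiM y hy).2⟩
      · exact absurd rfl hye
      · refine ⟨?_, fun h => ?_⟩
        · rintro rfl
          exact hML x hy (hSL hx)
        · have := (hML' y hy x (hSL hx) h.symm).2
          simp only [Set.mem_singleton_iff] at hxe
          tauto
    · rw [hFi, hFk]
      rintro x ⟨rfl | hx, hxe⟩ y ⟨rfl | hy, hye⟩
      · exact htt i k hik
      · refine ⟨fun h => htiT (h ▸ hy), fun h => ?_⟩
        obtain rfl := hti y (hLX (hTL hy)) h
        exact (hanti y hcS hye y hy hye).1 rfl
      · refine ⟨fun h => htkS (h ▸ hx), fun h => ?_⟩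
        obtain rfl := htk x (hLX (hSL hx)) h.symm
        exact (hanti x hx hxe x hdT hxe).1 rfl
      · exact hanti x hx hxe y hy hye
    · rw [hFk, hFj]
      rintro y ⟨rfl | hy, hye⟩ x ⟨rfl | hx, hxe⟩
      · exact absurd rfl hye
      · exact absurd rfl hye
      · exact ⟨(htkM y hy).1, fun h => (htkM y hy).2 h.symm⟩
      · refine ⟨?_, fun h => ?_⟩
        · rintro rfl
          exact hML y hy (hTL hx)
        · have := (hML' y hy x (hTL hx) h).2
          simp only [Set.mem_singleton_iff] at hxe
          tauto
  · right
    have heT : e ∉ T := fun h => hef (hfu e h hμe)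
    have hfS : f ∉ S := fun h => hef (heu f h hμf).symm
    have hkey : ∀ x ∈ S, ∀ y ∈ T, (x = y ∨ G.Adj x y) → x = e ∧ y = f := by
      intro x hx y hy hxy
      constructor
      · by_contra hxe
        have := hunion _ Set.sdiff_subset T subset_rfl (hSe x hx hxe).2 hT
          (hSe x hx hxe).1 hdT x ⟨hx, hxe⟩ y hy hxy
        rcases this.symm.subset (hSL heS) with h | h
        · exact h.2 rfl
        · exact heT h
      · by_contra hyf
        have := hunion S subset_rfl _ Set.sdiff_subset hS (hTf y hy hyf).2
          hcS (hTf y hy hyf).1 x hx y ⟨hy, hyf⟩ hxy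
        rcases this.symm.subset (hTL hfT) with h | h
        · exact hfS h
        · exact h.2 rfl
    have hef' : G.Adj e f := by
      obtain ⟨rfl, rfl⟩ := hkey a ha b hb hab
      exact hab.resolve_left hef
    obtain ⟨D, hDi, hDj, hDk⟩ := exists_fun3 hij hik hjk e μ f
    obtain ⟨F, hFi, hFj, hFk⟩ := exists_fun3 hij hik hjk (insert (t i) S) M (insert (t k) T)
    refine ⟨D, F, forall3 hij hik hjk ?_ ?_ ?_, forall3_pair hij hik hjk
      (fun a b h => h.symm) ?_ ?_ ?_, forall3_pair hij hik hjk ?_ ?_ ?_ ?_⟩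
    · rw [hFi, hDi]
      refine ⟨hS.cons hcS hic, Or.inr heS, Or.inl rfl, ?_⟩
      rintro x (rfl | hx)
      · simp
      · exact Or.inl (hLX (hSL hx))
    · rw [hFj, hDj]
      exact ⟨hM, hμM, htM, hM'⟩
    · rw [hFk, hDk]
      refine ⟨hT.cons hdT hkd, Or.inr hfT, Or.inl rfl, ?_⟩
      rintro x (rfl | hx)
      · simp
      · exact Or.inl (hLX (hTL hx))
    · rw [hDi, hDj]
      exact hμe.symm
    · rwa [hDi, hDk]
    · rwa [hDj, hDk]
    · intro a b h x hx y hy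
      exact ⟨(h y hy x hx).1.symm, fun e => ((h y hy x hx).2 e.symm).symm⟩
    · rw [hFi, hFj, hDi, hDj]
      rintro x (rfl | hx) y hy
      · exact ⟨(htiM y hy).1.symm, fun h => absurd h (htiM y hy).2⟩
      · refine ⟨?_, fun h => ?_⟩
        · rintro rfl
          exact hML x hy (hSL hx)
        · obtain ⟨h1, h2 | h2⟩ := hML' y hy x (hSL hx) h.symm
          · exact ⟨h2.2, h1⟩
          · exact absurd (h2.2 ▸ hx) hfS
    · rw [hFi, hFk, hDi, hDk]
      rintro x (rfl | hx) y (rfl | hy)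
      · exact ⟨(htt i k hik).1, fun h => absurd h (htt i k hik).2⟩
      · refine ⟨fun h => htiT (h ▸ hy), fun h => ?_⟩
        obtain rfl := hti y (hLX (hTL hy)) h
        exact absurd ((hkey y hcS y hy (Or.inl rfl)).1.symm.trans
          (hkey y hcS y hy (Or.inl rfl)).2) hef
      · refine ⟨fun h => htkS (h ▸ hx), fun h => ?_⟩
        obtain rfl := htk x (hLX (hSL hx)) h.symm
        exact absurd ((hkey x hx x hdT (Or.inl rfl)).1.symm.trans
          (hkey x hx x hdT (Or.inl rfl)).2) hef
      · refine ⟨?_, fun h => hkey x hx y hy (Or.inr h)⟩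
        rintro rfl
        obtain ⟨h1, h2⟩ := hkey x hx x hy (Or.inl rfl)
        exact hef (h1.symm.trans h2)
    · rw [hFk, hFj, hDj, hDk]
      rintro y hy x (rfl | hx)
      · exact ⟨(htkM y hy).1, fun h => absurd h.symm (htkM y hy).2⟩
      · refine ⟨?_, fun h => ?_⟩
        · rintro rfl
          exact hML y hy (hTL hx)
        · obtain ⟨h1, h2 | h2⟩ := hML' y hy x (hTL hx) h
          · exact absurd (h2.2 ▸ hx) heT
          · exact ⟨h1, h2.2⟩

/-! ### Gluing the two sides of a linkage -/

theorem Fan.mono {X Y : Set V} {C : Fin 3 → Set V} {j : Fin 3} {v : V} (h : G.Fan X C j v)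
    (hXY : X ⊆ Y) : G.Fan Y C j v := by
  obtain ⟨S, h1, h2⟩ := h
  exact ⟨S, fun i hi => ⟨(h1 i hi).1.trans hXY, (h1 i hi).2⟩, h2⟩

/-- Some connector contains vertices fanning into `X` or `X'` in a way that may obstruct a 3-path
configuration. -/
def HasCenter (G : SimpleGraph V) (X X' : Set V) (C : Fin 3 → Set V) : Prop :=
  ∃ j, ∃ v ∈ C j, (G.Fan X C j v ∧ ∃ x ∈ X', G.Adj v x) ∨ (G.Fan X' C j v ∧ ∃ x ∈ X, G.Adj v x) ∨
    ∃ v' ∈ C j, G.Adj v v' ∧ G.Fan X C j v ∧ G.Fan X' C j v'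

theorem HasCenter.symm {X X' : Set V} {C : Fin 3 → Set V} (h : G.HasCenter X X' C) :
    G.HasCenter X' X C := by
  obtain ⟨j, v, hv, h | h | ⟨v', hv', h1, h2, h3⟩⟩ := h
  · exact ⟨j, v, hv, Or.inr (Or.inl h)⟩
  · exact ⟨j, v, hv, Or.inl h⟩
  · exact ⟨j, v', hv', Or.inr (Or.inr ⟨v, hv, h1.symm, h3, h2⟩)⟩

theorem HasCenter.mono {X X' Y Y' : Set V} {C : Fin 3 → Set V} (h : G.HasCenter X X' C)
    (hX : X ⊆ Y) (hX' : X' ⊆ Y') : G.HasCenter Y Y' C := by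
  obtain ⟨j, v, hv, ⟨h, x, hx, e⟩ | ⟨h, x, hx, e⟩ | ⟨v', hv', h1, h2, h3⟩⟩ := h
  · exact ⟨j, v, hv, Or.inl ⟨h.mono hX, x, hX' hx, e⟩⟩
  · exact ⟨j, v, hv, Or.inr (Or.inl ⟨h.mono hX', x, hX hx, e⟩)⟩
  · exact ⟨j, v, hv, Or.inr (Or.inr ⟨v', hv', h1, h2.mono hX, h3.mono hX'⟩)⟩

/-- Three connected sets `Q i`, each attached to `X` at `p i` only and to `X'` at `q i` only. -/
structure Linkage (G : SimpleGraph V) (X X' : Set V) (C Q : Fin 3 → Set V) (p q : Fin 3 → V) :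
    Prop where
  anti : G.Anti X X'
  antiC : ∀ i k, i ≠ k → G.Anti (C i) (C k)
  disj : ∀ i, ∀ x ∈ C i, x ∉ X
  disj' : ∀ i, ∀ x ∈ C i, x ∉ X'
  conn : ∀ i, G.Conn (Q i)
  sub : ∀ i, Q i ⊆ C i
  memp : ∀ i, p i ∈ Q i
  memq : ∀ i, q i ∈ Q i
  adjp : ∀ i, ∃ x ∈ X, G.Adj (p i) x
  adjq : ∀ i, ∃ x ∈ X', G.Adj (q i) x
  uniqp : ∀ i, ∀ y ∈ Q i, ∀ x ∈ X, G.Adj y x → y = p i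
  uniqq : ∀ i, ∀ y ∈ Q i, ∀ x ∈ X', G.Adj y x → y = q i

namespace Linkage

variable {X X' : Set V} {C Q : Fin 3 → Set V} {p q : Fin 3 → V}

theorem symm (h : G.Linkage X X' C Q p q) : G.Linkage X' X C Q q p :=
  ⟨h.anti.symm, h.antiC, h.disj', h.disj, h.conn, h.sub, h.memq, h.memp, h.adjq, h.adjp,
    h.uniqq, h.uniqp⟩

theorem memp' (h : G.Linkage X X' C Q p q) (i : Fin 3) : p i ∈ C i := h.sub i (h.memp i)

theorem memq' (h : G.Linkage X X' C Q p q) (i : Fin 3) : q i ∈ C i := h.sub i (h.memq i)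

theorem touch_aux (h : G.Linkage X X' C Q p q) {A : Fin 3 → Set V} {E : Set V}
    (hA : ∀ i, A i ⊆ X ∪ {p i} ∪ E) (hpA : ∀ i, p i ∈ A i) {i k : Fin 3} (hik : i ≠ k) {x y : V}
    (hx : x ∈ A i) (hy : y ∈ Q k) (hxE : x ∉ E) (hxy : x = y ∨ G.Adj x y) : y ∈ A k := by
  have hx' := hA i hx
  rcases hx' with (hx' | rfl) | hx'
  · rcases hxy with rfl | hxy
    · exact absurd hx' (h.disj k _ (h.sub k hy))
    · rw [h.uniqp k y hy x hx' hxy.symm]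
      exact hpA k
  · have := h.antiC i k hik _ (h.memp' i) y (h.sub k hy)
    tauto
  · exact absurd hx' hxE

theorem touch (h : G.Linkage X X' C Q p q) {A A' : Fin 3 → Set V} {E : Set V}
    (hA : ∀ i, A i ⊆ X ∪ {p i} ∪ E) (hpA : ∀ i, p i ∈ A i)
    (hA' : ∀ i, A' i ⊆ X' ∪ {q i} ∪ E) (hqA' : ∀ i, q i ∈ A' i)
    {i k : Fin 3} (hik : i ≠ k) {x y : V} (hx : x ∈ A i ∪ Q i ∪ A' i) (hy : y ∈ A k ∪ Q k ∪ A' k)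
    (hxE : x ∉ E) (hyE : y ∉ E) (hxy : x = y ∨ G.Adj x y) :
    (x ∈ A i ∧ y ∈ A k) ∨ (x ∈ A' i ∧ y ∈ A' k) := by
  have hyx : y = x ∨ G.Adj y x := hxy.imp Eq.symm Adj.symm
  have main : ∀ {X X' : Set V} {p q : Fin 3 → V} {A A' : Fin 3 → Set V},
      G.Linkage X X' C Q p q → (∀ i, A i ⊆ X ∪ {p i} ∪ E) → (∀ i, p i ∈ A i) →
      (∀ i, A' i ⊆ X' ∪ {q i} ∪ E) → (∀ i, q i ∈ A' i) → ∀ {i k : Fin 3}, i ≠ k → ∀ {x y : V},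
      x ∈ A i → y ∈ A' k → x ∉ E → y ∉ E → (x = y ∨ G.Adj x y) →
      (x ∈ A i ∧ y ∈ A k) ∨ (x ∈ A' i ∧ y ∈ A' k) := by
    intro X X' p q A A' h hA hpA hA' hqA' i k hik x y hx hy hxE hyE hxy
    have hyx : y = x ∨ G.Adj y x := hxy.imp Eq.symm Adj.symm
    rcases hA i hx with (hx' | rfl) | hx'
    · rcases hA' k hy with (hy' | rfl) | hy'
      · have := h.anti x hx' y hy'
        tauto
      · exact Or.inl ⟨hx, h.touch_aux hA hpA hik hx (h.memq k) hxE hxy⟩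
      · exact absurd hy' hyE
    · exact Or.inr ⟨h.symm.touch_aux hA' hqA' hik.symm hy (h.memp i) hyE hyx, hy⟩
    · exact absurd hx' hxE
  rcases hx with (hx | hx) | hx <;> rcases hy with (hy | hy) | hy
  · exact Or.inl ⟨hx, hy⟩
  · exact Or.inl ⟨hx, h.touch_aux hA hpA hik hx hy hxE hxy⟩
  · exact main h hA hpA hA' hqA' hik hx hy hxE hyE hxy
  · exact Or.inl ⟨h.touch_aux hA hpA hik.symm hy hx hyE hyx, hy⟩
  · have := h.antiC i k hik x (h.sub i hx) y (h.sub k hy)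
    tauto
  · exact Or.inr ⟨h.symm.touch_aux hA' hqA' hik.symm hy hx hyE hyx, hy⟩
  · exact (main h.symm hA' hqA' hA hpA hik hx hy hxE hyE hxy).symm
  · exact Or.inr ⟨hx, h.symm.touch_aux hA' hqA' hik hx hy hxE hxy⟩
  · exact Or.inr ⟨hx, hy⟩

theorem conn_union (h : G.Linkage X X' C Q p q) {A A' : Set V} {i : Fin 3} (hA : G.Conn A)
    (hA' : G.Conn A') (hp : p i ∈ A) (hq : q i ∈ A') : G.Conn (A ∪ Q i ∪ A') :=
  (hA.union_of_mem (h.conn i) hp (h.memp i)).union_of_mem hA' (Or.inr (h.memq i)) hq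

/-- The theta needs distinct nonadjacent hubs. Hubs in `X` and `X'` are separate, as are terminals
of different connectors; each remaining coincidence or adjacency is one clause of `HasCenter`. -/
theorem hub_hub (h : G.Linkage X X' C Q p q) {a b : V} {F F' : Fin 3 → Set V}
    (hF : G.IsHub X p a F) (hF' : G.IsHub X' q b F')
    (ha : a ∈ X ∨ ∃ j, a = p j ∧ G.Fan X C j (p j))
    (hb : b ∈ X' ∨ ∃ j, b = q j ∧ G.Fan X' C j (q j)) : G.HasConfig ∨ G.HasCenter X X' C := by
  by_cases hab : a ≠ b ∧ ¬ G.Adj a b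
  · left
    refine hasConfig_of_theta hab.1 hab.2 (F := fun i => F i ∪ Q i ∪ F' i)
      (fun i => h.conn_union (hF.1 i).1 (hF'.1 i).1 (hF.1 i).2.2.1 (hF'.1 i).2.2.1)
      (fun i => Or.inl (Or.inl (hF.1 i).2.1)) (fun i => Or.inr (hF'.1 i).2.1) ?_
    intro i k hik x hx y hy hxa hxb hya hyb
    by_contra hxy
    have hxy : x = y ∨ G.Adj x y := by tauto
    have := h.touch (E := {a, b}) (A := F) (A' := F') (fun i z hz => ?_) (fun i => (hF.1 i).2.2.1)
      (fun i z hz => ?_) (fun i => (hF'.1 i).2.2.1) hik hx hy (by simp [hxa, hxb])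
      (by simp [hya, hyb]) hxy
    · rcases this with ⟨h1, h2⟩ | ⟨h1, h2⟩
      · have := hF.2 i k hik x ⟨h1, hxa⟩ y ⟨h2, hya⟩
        tauto
      · have := hF'.2 i k hik x ⟨h1, hxb⟩ y ⟨h2, hyb⟩
        tauto
    · have := (hF.1 i).2.2.2 hz
      simp only [Set.mem_union, Set.mem_insert_iff, Set.mem_singleton_iff] at this ⊢
      tauto
    · have := (hF'.1 i).2.2.2 hz
      simp only [Set.mem_union, Set.mem_insert_iff, Set.mem_singleton_iff] at this ⊢
      tauto
  · right
    have hab : a = b ∨ G.Adj a b := by tauto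
    rcases ha with ha | ⟨j, rfl, hj⟩
    · rcases hb with hb | ⟨k, rfl, hk⟩
      · have := h.anti a ha b hb
        tauto
      · rcases hab with rfl | hab
        · exact absurd ha (h.disj k _ (h.memq' k))
        · exact ⟨k, q k, h.memq' k, Or.inr (Or.inl ⟨hk, a, ha, hab.symm⟩)⟩
    · rcases hb with hb | ⟨k, rfl, hk⟩
      · rcases hab with rfl | hab
        · exact absurd hb (h.disj' j _ (h.memp' j))
        · exact ⟨j, p j, h.memp' j, Or.inl ⟨hj, b, hb, hab⟩⟩
      · by_cases hjk : j = k
        · subst hjk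
          rcases hab with hab | hab
          · exact ⟨j, p j, h.memp' j, Or.inl ⟨hj, by rw [hab]; exact h.adjq j⟩⟩
          · exact ⟨j, p j, h.memp' j, Or.inr (Or.inr ⟨q j, h.memq' j, hab, hj, hk⟩)⟩
        · have := h.antiC j k hjk _ (h.memp' j) _ (h.memq' k)
          tauto

/-- At most one triangle vertex is a terminal `q i`, terminals being nonadjacent. Without a center
the apex sees no triangle vertex in `X'`, so at least two paths have length at least two. -/
theorem hub_tri (h : G.Linkage X X' C Q p q) {a : V} {d : Fin 3 → V} {F F' : Fin 3 → Set V}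
    (hF : G.IsHub X p a F) (hF' : G.IsTri X' q d F')
    (ha : a ∈ X ∨ ∃ j, a = p j ∧ G.Fan X C j (p j)) : G.HasConfig ∨ G.HasCenter X X' C := by
  by_cases hc : G.HasCenter X X' C
  · exact Or.inr hc
  left
  have hd : ∀ i, d i ∈ X' ∨ d i = q i := fun i => (hF'.1 i).2.2.2 (hF'.1 i).2.1
  have hdd : ∀ i k, i ≠ k → d i = q i → d k = q k → False := by
    intro i k hik h1 h2
    have := hF'.2.1 i k hik
    rw [h1, h2] at this
    exact (h.antiC i k hik _ (h.memq' i) _ (h.memq' k)).2 this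
  have had : ∀ i, a ≠ d i := by
    rintro i rfl
    rcases ha with ha | ⟨j, hj, hjF⟩
    · rcases hd i with hi | hi
      · exact (h.anti _ ha _ hi).1 rfl
      · exact h.disj i _ (h.memq' i) (hi ▸ ha)
    · rcases hd i with hi | hi
      · exact h.disj' j _ (h.memp' j) (hj ▸ hi)
      · by_cases hij : i = j
        · subst hij
          exact hc ⟨i, p i, h.memp' i, Or.inl ⟨hjF, by rw [← hj, hi]; exact h.adjq i⟩⟩
        · exact (h.antiC i j hij _ (h.memq' i) _ (h.memp' j)).1 (hi.symm.trans hj)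
  have had' : ∀ i, G.Adj a (d i) → d i = q i := by
    intro i hi
    rcases hd i with hi' | hi'
    · exfalso
      rcases ha with ha | ⟨j, hj, hjF⟩
      · exact (h.anti _ ha _ hi').2 hi
      · exact hc ⟨j, p j, h.memp' j, Or.inl ⟨hjF, d i, hi', hj ▸ hi⟩⟩
    · exact hi'
  have hadj : ∃ i j, i ≠ j ∧ ¬ G.Adj a (d i) ∧ ¬ G.Adj a (d j) := by
    by_contra! hh
    have h01 := fun h => had' _ (hh 0 1 (by decide) h)
    have h02 := fun h => had' _ (hh 0 2 (by decide) h)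
    have h12 := fun h => had' _ (hh 1 2 (by decide) h)
    by_cases h0 : G.Adj a (d 0)
    · by_cases h1 : G.Adj a (d 1)
      · exact hdd 0 1 (by decide) (had' 0 h0) (had' 1 h1)
      · exact hdd 0 2 (by decide) (had' 0 h0) (h12 h1)
    · exact hdd 1 2 (by decide) (h01 h0) (h02 h0)
  refine hasConfig_of_pyramid (a := a) (b := d) (F := fun i => F i ∪ Q i ∪ F' i) had hadj hF'.2.1
    (fun i => h.conn_union (hF.1 i).1 (hF'.1 i).1 (hF.1 i).2.2.1 (hF'.1 i).2.2.1)
    (fun i => Or.inl (Or.inl (hF.1 i).2.1)) (fun i => Or.inr (hF'.1 i).2.1) ?_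
  intro i k hik x hx y hy hxa hya
  have key : (x = y ∨ G.Adj x y) → x ∈ F' i ∧ y ∈ F' k := by
    intro hxy
    have := h.touch (E := {a}) (A := F) (A' := F') (fun i z hz => ?_) (fun i => (hF.1 i).2.2.1)
      (fun i z hz => ?_) (fun i => (hF'.1 i).2.2.1) hik hx hy hxa hya hxy
    · refine this.resolve_left ?_
      rintro ⟨h1, h2⟩
      have := hF.2 i k hik x ⟨h1, hxa⟩ y ⟨h2, hya⟩
      tauto
    · have := (hF.1 i).2.2.2 hz
      simp only [Set.mem_union, Set.mem_insert_iff, Set.mem_singleton_iff] at this ⊢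
      tauto
    · exact Or.inl ((hF'.1 i).2.2.2 hz)
  refine ⟨fun hxy => ?_, fun hxy => ?_⟩
  · obtain ⟨h1, h2⟩ := key (Or.inl hxy)
    exact (hF'.2.2 i k hik x h1 y h2).1 hxy
  · obtain ⟨h1, h2⟩ := key (Or.inr hxy)
    exact (hF'.2.2 i k hik x h1 y h2).2 hxy

/-- If the triangles share a vertex, it is `p i = q i`. The other corners then lie in the separate
sets `X` and `X'`, as the degenerate prism requires. -/
theorem tri_tri (h : G.Linkage X X' C Q p q) {d d' : Fin 3 → V} {F F' : Fin 3 → Set V}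
    (hF : G.IsTri X p d F) (hF' : G.IsTri X' q d' F') : G.HasConfig := by
  have hd : ∀ i, d i ∈ X ∨ d i = p i := fun i => (hF.1 i).2.2.2 (hF.1 i).2.1
  have hd' : ∀ i, d' i ∈ X' ∨ d' i = q i := fun i => (hF'.1 i).2.2.2 (hF'.1 i).2.1
  have hdd : ∀ i k, i ≠ k → d i = p i → d k = p k → False := by
    intro i k hik h1 h2
    have := hF.2.1 i k hik
    rw [h1, h2] at this
    exact (h.antiC i k hik _ (h.memp' i) _ (h.memp' k)).2 this
  have hdd' : ∀ i k, i ≠ k → d' i = q i → d' k = q k → False := by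
    intro i k hik h1 h2
    have := hF'.2.1 i k hik
    rw [h1, h2] at this
    exact (h.antiC i k hik _ (h.memq' i) _ (h.memq' k)).2 this
  refine hasConfig_of_prism (d := d) (d' := d') (E := fun i => F i ∪ Q i ∪ F' i) hF.2.1 hF'.2.1
    (fun i => h.conn_union (hF.1 i).1 (hF'.1 i).1 (hF.1 i).2.2.1 (hF'.1 i).2.2.1)
    (fun i => Or.inl (Or.inl (hF.1 i).2.1)) (fun i => Or.inr (hF'.1 i).2.1) ?_ ?_
  · by_cases he : ∀ i, d i ≠ d' i
    · exact Or.inl he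
    push Not at he
    obtain ⟨i, hi⟩ := he
    have hi1 : d i = p i := by
      refine (hd i).resolve_left fun hdX => ?_
      rcases hd' i with h1 | h1
      · exact (h.anti _ hdX _ h1).1 hi
      · exact h.disj i _ (h.memq' i) (by rwa [← h1, ← hi])
    have hi2 : d' i = q i := by
      refine (hd' i).resolve_left fun hdX => ?_
      exact h.disj' i _ (h.memp' i) (by rwa [← hi1, hi])
    exact Or.inr ⟨i, hi, fun k hk => h.anti _ ((hd k).resolve_right fun e => hdd k i hk e hi1) _
      ((hd' k).resolve_right fun e => hdd' k i hk e hi2)⟩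
  · intro i k hik x hx y hy
    have key := fun hxy => h.touch (E := ∅) (A := F) (A' := F')
      (fun i z hz => Or.inl ((hF.1 i).2.2.2 hz)) (fun i => (hF.1 i).2.2.1)
      (fun i z hz => Or.inl ((hF'.1 i).2.2.2 hz)) (fun i => (hF'.1 i).2.2.1) hik hx hy
      (Set.notMem_empty _) (Set.notMem_empty _) hxy
    refine ⟨fun hxy => ?_, fun hxy => ?_⟩
    · rcases key (Or.inl hxy) with ⟨h1, h2⟩ | ⟨h1, h2⟩
      · exact (hF.2.2 i k hik x h1 y h2).1 hxy
      · exact (hF'.2.2 i k hik x h1 y h2).1 hxy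
    · rcases key (Or.inr hxy) with ⟨h1, h2⟩ | ⟨h1, h2⟩
      · exact Or.inl ((hF.2.2 i k hik x h1 y h2).2 hxy)
      · exact Or.inr ((hF'.2.2 i k hik x h1 y h2).2 hxy)

end Linkage

/-- Two separate connected sets joined by three separate connected connectors yield a 3-path
configuration unless some connector contains a center. -/
theorem hasConfig_or_hasCenter [Finite V] {X X' : Set V} {C : Fin 3 → Set V} (hX : G.Conn X)
    (hX' : G.Conn X') (hXX' : G.Anti X X') (hC : ∀ i, G.Conn (C i))
    (hCC : ∀ i k, i ≠ k → G.Anti (C i) (C k)) (hCX : ∀ i, ∀ x ∈ C i, x ∉ X ∧ x ∉ X')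
    (hs : ∀ i, G.Sees (C i) X ∧ G.Sees (C i) X') : G.HasConfig ∨ G.HasCenter X X' C := by
  obtain ⟨Y, hYX, ⟨hY, hYs⟩, hYmin⟩ := exists_minimal_subset
    (P := fun Y => G.Conn Y ∧ ∀ i, G.Sees (C i) Y) ⟨hX, fun i => (hs i).1⟩
  obtain ⟨Y', hYX', ⟨hY', hYs'⟩, hYmin'⟩ := exists_minimal_subset
    (P := fun Y => G.Conn Y ∧ ∀ i, G.Sees (C i) Y) ⟨hX', fun i => (hs i).2⟩
  have hQ : ∀ i, ∃ Q p q, Q ⊆ C i ∧ G.Conn Q ∧ p ∈ Q ∧ q ∈ Q ∧ (∃ x ∈ Y, G.Adj p x) ∧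
      (∃ x ∈ Y', G.Adj q x) ∧ (∀ y ∈ Q, ∀ x ∈ Y, G.Adj y x → y = p) ∧
      (∀ y ∈ Q, ∀ x ∈ Y', G.Adj y x → y = q) := by
    intro i
    obtain ⟨Q, hQC, ⟨hQ, h1, h2⟩, hmin⟩ := exists_minimal_subset
      (P := fun Q => G.Conn Q ∧ (∃ y ∈ Q, y ∈ {y | ∃ x ∈ Y, G.Adj y x}) ∧
        (∃ y ∈ Q, y ∈ {y | ∃ x ∈ Y', G.Adj y x})) ⟨hC i, hYs i, hYs' i⟩
    obtain ⟨p, hp, q, hq, hpY, hqY, hp', hq'⟩ := hQ.unique_of_minimal h1 h2 hmin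
    exact ⟨Q, p, q, hQC, hQ, hp, hq, hpY, hqY, fun y hy x hx e => hp' y hy ⟨x, hx, e⟩,
      fun y hy x hx e => hq' y hy ⟨x, hx, e⟩⟩
  choose Q p q hQC hQ hp hq hpY hqY hp' hq' using hQ
  have L : G.Linkage Y Y' C Q p q :=
    ⟨hXX'.mono hYX hYX', hCC, fun i x hx h => (hCX i x hx).1 (hYX h),
      fun i x hx h => (hCX i x hx).2 (hYX' h), hQ, hQC, hp, hq, hpY, hqY, hp', hq'⟩
  have T1 := hub_or_tri (C := C) (t := p) hY (fun Z hZ h1 h2 => hYmin Z hZ ⟨h1, h2⟩) L.memp' hpY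
    (fun i k hik => hCC i k hik _ (L.memp' i) _ (L.memp' k)) (fun i => L.disj i _ (L.memp' i))
  have T2 := hub_or_tri (C := C) (t := q) hY' (fun Z hZ h1 h2 => hYmin' Z hZ ⟨h1, h2⟩) L.memq' hqY
    (fun i k hik => hCC i k hik _ (L.memq' i) _ (L.memq' k)) (fun i => L.disj' i _ (L.memq' i))
  have main : G.HasConfig ∨ G.HasCenter Y Y' C := by
    rcases T1 with ⟨a, F, hF, ha⟩ | ⟨d, F, hF⟩ <;> rcases T2 with ⟨b, F', hF', hb⟩ | ⟨d', F', hF'⟩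
    · exact L.hub_hub hF hF' ha hb
    · exact L.hub_tri hF hF' ha
    · exact (L.symm.hub_tri hF' hF hb).imp_right HasCenter.symm
    · exact Or.inl (L.tri_tri hF hF')
  exact main.imp_right fun h => h.mono hYX hYX'


-- Branch sets of an induced minor

universe u v

theorem Conn.image {V W : Type*} {G : SimpleGraph V} {H : SimpleGraph W} {S : Set V}
    (hS : G.Conn S) (f : V → W) (hf : ∀ x y, G.Adj x y → H.Adj (f x) (f y)) :
    H.Conn (f '' S) := by
  refine ⟨hS.1.image f, ?_⟩
  rintro T ⟨_, ⟨x, hx, rfl⟩, hxT⟩ hT _ ⟨y, hy, rfl⟩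
  exact hS.2 (f ⁻¹' T) ⟨x, hx, hxT⟩ (fun a ha haT b hb e =>
    hT _ ⟨a, ha, rfl⟩ haT _ ⟨b, hb, rfl⟩ (hf a b e)) hy

/-- Used for the map that undoes a contraction: its fibres are single vertices and the contracted
edge. -/
theorem Conn.preimage {V W : Type*} {G : SimpleGraph V} {H : SimpleGraph W} {S : Set W}
    (hS : H.Conn S) (f : V → W) (hfib : ∀ a, G.Conn (f ⁻¹' {a}))
    (hf : ∀ a b, H.Adj a b → ∃ x y, f x = a ∧ f y = b ∧ G.Adj x y) : G.Conn (f ⁻¹' S) := by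
  obtain ⟨s, hs⟩ := hS.1
  obtain ⟨y, hy⟩ := (hfib s).1
  obtain rfl : f y = s := hy
  refine ⟨⟨y, hs⟩, ?_⟩
  rintro T ⟨x, hx, hxT⟩ hT
  have hfT : ∀ a ∈ S, ∀ x, f x = a → x ∈ T → f ⁻¹' {a} ⊆ T := by
    rintro a ha x rfl hxT
    refine (hfib (f x)).2 T ⟨x, rfl, hxT⟩ ?_
    rintro b hb hbT c hc e
    have hb : f b = f x := hb
    have hc : f c = f x := hc
    exact hT b (by rwa [Set.mem_preimage, hb]) hbT c (by rwa [Set.mem_preimage, hc]) e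
  have := hS.2 {a | f ⁻¹' {a} ⊆ T} ⟨f x, hx, hfT _ hx x rfl hxT⟩ (by
    rintro a ha haT b hb e
    obtain ⟨p, q, rfl, rfl, hpq⟩ := hf a b e
    exact hfT _ hb q rfl (hT p ha (haT rfl) q hb hpq))
  exact fun z hz => this hz rfl

/-- The branch sets of an induced minor. -/
theorem IsInducedMinor.exists_branch_sets {W : Type v} {H : SimpleGraph W} {V : Type u}
    {G : SimpleGraph V} (h : IsInducedMinor H G) :
    ∃ φ : W → Set V, (∀ w, G.Conn (φ w)) ∧ (∀ w w', w ≠ w' → ∀ x ∈ φ w, x ∉ φ w') ∧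
      ∀ w w', w ≠ w' → (H.Adj w w' ↔ G.Sees (φ w) (φ w')) := by
  induction h with
  | of_iso e =>
    obtain ⟨e⟩ := e
    refine ⟨fun w => {e w}, fun w => conn_singleton _, ?_, ?_⟩
    · rintro w w' hne x hx hx'
      exact hne (e.injective ((Set.mem_singleton_iff.1 hx).symm.trans hx'))
    · intro w w' _
      simpa [Sees] using e.map_adj_iff.symm
  | of_deleteVertex w h ih =>
    obtain ⟨φ, h1, h2, h3⟩ := ih
    refine ⟨fun u => Subtype.val '' φ u, fun u => (h1 u).image _ fun x y e => e, ?_, ?_⟩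
    · rintro u u' hne _ ⟨x, hx, rfl⟩ ⟨y, hy, hxy⟩
      exact h2 u u' hne x hx (Subtype.ext hxy ▸ hy)
    · intro u u' hne
      rw [h3 u u' hne]
      constructor
      · rintro ⟨x, hx, y, hy, e⟩
        exact ⟨x, ⟨x, hx, rfl⟩, y, ⟨y, hy, rfl⟩, e⟩
      · rintro ⟨_, ⟨x, hx, rfl⟩, _, ⟨y, hy, rfl⟩, e⟩
        exact ⟨x, hx, y, hy, e⟩
  | @of_contract V G z w hzw h ih =>
    classical
    obtain ⟨φ, h1, h2, h3⟩ := ih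
    obtain ⟨f, hfw, hf⟩ : ∃ f : V → {x : V // x ≠ w}, f w = ⟨z, hzw.ne⟩ ∧
        ∀ x (hx : x ≠ w), f x = ⟨x, hx⟩ :=
      ⟨fun x => if hx : x = w then ⟨z, hzw.ne⟩ else ⟨x, hx⟩, by simp, fun x hx => by simp [hx]⟩
    have hfz : f z = ⟨z, hzw.ne⟩ := hf z hzw.ne
    have hadj : ∀ a b, (G.contract z w).Adj a b ↔
        a ≠ b ∧ ∃ x y, f x = a ∧ f y = b ∧ G.Adj x y := by
      rintro ⟨a, ha⟩ ⟨b, hb⟩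
      refine and_congr_right fun hne => ⟨?_, ?_⟩
      · rintro (e | ⟨rfl, e⟩ | ⟨rfl, e⟩)
        · exact ⟨a, b, hf a ha, hf b hb, e⟩
        · exact ⟨w, b, hfw, hf b hb, e⟩
        · exact ⟨a, w, hf a ha, hfw, e⟩
      · rintro ⟨x, y, hx, hy, e⟩
        by_cases hxw : x = w
        · subst hxw
          have hyx : y ≠ x := e.ne.symm
          rw [hf y hyx] at hy
          cases hy
          rw [hfw] at hx
          cases hx
          exact Or.inr (Or.inl ⟨rfl, e⟩)
        · rw [hf x hxw] at hx
          cases hx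
          by_cases hyw : y = w
          · subst hyw
            rw [hfw] at hy
            cases hy
            exact Or.inr (Or.inr ⟨rfl, e⟩)
          · rw [hf y hyw] at hy
            cases hy
            exact Or.inl e
    have hfib : ∀ a, G.Conn (f ⁻¹' {a}) := by
      rintro ⟨a, ha⟩
      by_cases haz : a = z
      · subst haz
        have : f ⁻¹' {⟨a, ha⟩} = {a, w} := by
          ext x
          by_cases hx : x = w
          · simp [hx, hfw]
          · simp [hf x hx, hx]
        rw [this]
        exact conn_pair hzw
      · have : f ⁻¹' {⟨a, ha⟩} = {a} := by
          ext x
          by_cases hx : x = w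
          · simp [hx, hfw, Ne.symm ha, Ne.symm haz]
          · simp [hf x hx]
        rw [this]
        exact conn_singleton a
    refine ⟨fun u => f ⁻¹' φ u, fun u => (h1 u).preimage f hfib fun a b e => ((hadj a b).1 e).2,
      fun u u' hne x hx hx' => h2 u u' hne _ hx hx', ?_⟩
    intro u u' hne
    rw [h3 u u' hne]
    constructor
    · rintro ⟨a, ha, b, hb, e⟩
      obtain ⟨-, x, y, rfl, rfl, hxy⟩ := (hadj a b).1 e
      exact ⟨x, ha, y, hb, hxy⟩
    · rintro ⟨x, hx, y, hy, e⟩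
      refine ⟨f x, hx, f y, hy, (hadj _ _).2 ⟨?_, x, y, rfl, rfl, e⟩⟩
      intro he
      exact h2 u u' hne (f x) hx (he ▸ hy)

/-- The branch sets of an induced `K_{3,4}`-minor. -/
structure Model (G : SimpleGraph V) (A : Fin 3 → Set V) (B : Fin 4 → Set V) : Prop where
  connA : ∀ i, G.Conn (A i)
  connB : ∀ j, G.Conn (B j)
  antiA : ∀ i k, i ≠ k → G.Anti (A i) (A k)
  antiB : ∀ j l, j ≠ l → G.Anti (B j) (B l)
  disj : ∀ i j, ∀ x ∈ A i, x ∉ B j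
  sees : ∀ i j, G.Sees (A i) (B j)

theorem IsInducedMinor.exists_model
    (h : IsInducedMinor (completeBipartiteGraph (Fin 3) (Fin 4)) G) : ∃ A B, G.Model A B := by
  obtain ⟨φ, h1, h2, h3⟩ := h.exists_branch_sets
  have hanti : ∀ w w', w ≠ w' → ¬ (completeBipartiteGraph (Fin 3) (Fin 4)).Adj w w' →
      G.Anti (φ w) (φ w') := by
    intro w w' hne hadj x hx y hy
    refine ⟨fun e => h2 w w' hne x hx (e ▸ hy), fun e => hadj ?_⟩
    exact (h3 w w' hne).2 ⟨x, hx, y, hy, e⟩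
  exact ⟨fun i => φ (Sum.inl i), fun j => φ (Sum.inr j), fun i => h1 _, fun j => h1 _,
    fun i k hik => hanti _ _ (by simpa using hik) (by simp),
    fun i k hik => hanti _ _ (by simpa using hik) (by simp),
    fun i j => h2 _ _ (by simp), fun i j => (h3 _ _ (by simp)).1 (by simp)⟩

/-! ### Small and large sets in a minimal model -/

/-- No two nonempty subsets of `B` are separate. -/
def Small (G : SimpleGraph V) (B : Set V) : Prop :=
  ∀ S ⊆ B, ∀ T ⊆ B, S.Nonempty → T.Nonempty → ¬ G.Anti S T

/-- `B` is a minimal connected set with two nonadjacent ends, the end `e i` being the only vertex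
of `B` seeing `A i`, and both ends seeing `A f`. -/
structure Large (G : SimpleGraph V) (A : Fin 3 → Set V) (B : Set V) (f : Fin 3) (e : Fin 3 → V) :
    Prop where
  mem : ∀ i, i ≠ f → e i ∈ B
  adj : ∀ i, i ≠ f → ∃ a ∈ A i, G.Adj a (e i)
  uniq : ∀ i, i ≠ f → ∀ a ∈ A i, ∀ x ∈ B, G.Adj a x → x = e i
  adjf : ∀ i, i ≠ f → ∃ a ∈ A f, G.Adj a (e i)
  anti : ∀ i k, i ≠ f → k ≠ f → i ≠ k → e i ≠ e k ∧ ¬ G.Adj (e i) (e k)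
  min : ∀ Z ⊆ B, G.Conn Z → (∀ i, i ≠ f → e i ∈ Z) → Z = B

/-- A model in which the sets `B j` have the least possible total size. -/
structure MinModel (G : SimpleGraph V) (A : Fin 3 → Set V) (B : Fin 4 → Set V) : Prop
    extends G.Model A B where
  min : ∀ A' B', G.Model A' B' → ∑ j, (B j).ncard ≤ ∑ j, (B' j).ncard

theorem Model.exists_minModel {A : Fin 3 → Set V} {B : Fin 4 → Set V} (h : G.Model A B) :
    ∃ A B, G.MinModel A B := by
  classical
  have hex : ∃ n, ∃ A B, G.Model A B ∧ ∑ j, (B j).ncard = n := ⟨_, A, B, h, rfl⟩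
  obtain ⟨A', B', h', hn⟩ := Nat.find_spec hex
  exact ⟨A', B', h', fun A'' B'' h'' => hn ▸ Nat.find_min' hex ⟨A'', B'', h'', rfl⟩⟩

/-- Only the sets `B j` are weighed, so the sets `A i` may grow at no cost. -/
theorem MinModel.not_ssubset [Finite V] {A A' : Fin 3 → Set V} {B : Fin 4 → Set V}
    (h : G.MinModel A B) {j : Fin 4} {Z : Set V} (hZ : Z ⊆ B j)
    (h' : G.Model A' (Function.update B j Z)) : Z = B j := by
  by_contra hne
  refine absurd (h.min _ _ h') (not_le.2 ?_)
  refine Finset.sum_lt_sum (fun l _ => ?_) ⟨j, Finset.mem_univ _, ?_⟩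
  · by_cases hl : l = j
    · subst hl
      simpa using Set.ncard_le_ncard hZ
    · simp [hl]
  · simpa using Set.ncard_lt_ncard (hZ.ssubset_of_ne hne)

theorem Model.update [Finite V] {A : Fin 3 → Set V} {B : Fin 4 → Set V} (h : G.Model A B)
    {j : Fin 4} {Z : Set V} (hZ : Z ⊆ B j) (hc : G.Conn Z) {A' : Fin 3 → Set V}
    (hA' : ∀ i, G.Conn (A' i)) (hAA : ∀ i, A i ⊆ A' i)
    (hanti : ∀ i k, i ≠ k → G.Anti (A' i) (A' k)) (hdisj : ∀ i l, l ≠ j → ∀ x ∈ A' i, x ∉ B l)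
    (hdisj' : ∀ i, ∀ x ∈ A' i, x ∉ Z) (hs : ∀ i, G.Sees (A' i) Z) :
    G.Model A' (Function.update B j Z) := by
  refine ⟨hA', ?_, hanti, ?_, ?_, ?_⟩
  · intro l
    by_cases hl : l = j
    · subst hl
      simpa using hc
    · simpa [hl] using h.connB l
  · have hsub : ∀ l, Function.update B j Z l ⊆ B l := by
      intro l
      by_cases hl : l = j
      · subst hl
        simpa using hZ
      · simp [hl]
    exact fun l m hlm => (h.antiB l m hlm).mono (hsub l) (hsub m)
  · intro i l x hx
    by_cases hl : l = j
    · subst hl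
      simpa using hdisj' i x hx
    · simpa [hl] using hdisj i l hl x hx
  · intro i l
    by_cases hl : l = j
    · subst hl
      simpa using hs i
    · simpa [hl] using (h.sees i l).mono (hAA i) subset_rfl

theorem MinModel.eq_of_subset [Finite V] {A : Fin 3 → Set V} {B : Fin 4 → Set V}
    (h : G.MinModel A B) {j : Fin 4} {Z : Set V} (hZ : Z ⊆ B j) (hc : G.Conn Z)
    (hs : ∀ i, G.Sees (A i) Z) : Z = B j :=
  h.not_ssubset hZ (h.update hZ hc h.connA (fun _ => subset_rfl) h.antiA
    (fun i l _ => h.disj i l) (fun i x hx hxZ => h.disj i j x hx (hZ hxZ)) hs)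

theorem small_singleton (v : V) : G.Small {v} := by
  rintro S hS T hT ⟨x, hx⟩ ⟨y, hy⟩ h
  exact (h x hx y hy).1 ((hS hx).trans (hT hy).symm)

theorem small_pair {c d : V} (h : G.Adj c d) : G.Small {c, d} := by
  rintro S hS T hT ⟨x, hx⟩ ⟨y, hy⟩ hST
  have := hST x hx y hy
  rcases hS hx with rfl | hx' <;> rcases hT hy with rfl | hy'
  · exact this.1 rfl
  · exact this.2 (Set.mem_singleton_iff.1 hy' ▸ h)
  · exact this.2 (Set.mem_singleton_iff.1 hx' ▸ h.symm)
  · exact this.1 (hx'.trans hy'.symm)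

theorem MinModel.noncut [Finite V] {A : Fin 3 → Set V} {B : Fin 4 → Set V} (h : G.MinModel A B)
    {j : Fin 4} {c : V} (hc : c ∈ B j) (hcB : G.Conn (B j \ {c})) :
    ∃ i, (∃ a ∈ A i, G.Adj a c) ∧ (∀ a ∈ A i, ∀ x ∈ B j, G.Adj a x → x = c) ∧
      ∃ l, l ≠ i ∧ ∃ a ∈ A l, G.Adj a c := by
  obtain ⟨i, hi⟩ : ∃ i, ¬ G.Sees (A i) (B j \ {c}) := by
    by_contra! hh
    have := h.eq_of_subset Set.sdiff_subset hcB hh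
    exact (this.symm.subset hc).2 rfl
  have hi' : ∀ a ∈ A i, ∀ x ∈ B j, G.Adj a x → x = c := by
    intro a ha x hx e
    by_contra hxc
    exact hi ⟨a, ha, x, ⟨hx, hxc⟩, e⟩
  obtain ⟨a, ha, x, hx, e⟩ := h.sees i j
  obtain rfl := hi' a ha x hx e
  refine ⟨i, ⟨a, ha, e⟩, hi', ?_⟩
  -- If no other `A l` saw `x`, then `x` could be moved from `B j` to `A i`: the enlarged `A i`
  -- still sees the rest of `B j` by connectivity, and the total size drops.
  by_contra! hl
  have hmem : ∀ l y, y ∈ Function.update A i (insert x (A i)) l → y ∈ A l ∨ (l = i ∧ y = x) := by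
    intro l y hy
    by_cases hli : l = i
    · subst hli
      rw [Function.update_self] at hy
      rcases hy with rfl | hy
      · exact Or.inr ⟨rfl, rfl⟩
      · exact Or.inl hy
    · rw [Function.update_of_ne hli] at hy
      exact Or.inl hy
  have hsub : ∀ l, A l ⊆ Function.update A i (insert x (A i)) l := by
    intro l
    by_cases hli : l = i
    · subst hli
      rw [Function.update_self]
      exact Set.subset_insert _ _
    · rw [Function.update_of_ne hli]
  have := h.not_ssubset (A' := Function.update A i (insert x (A i)))
    (Z := B j \ {x}) Set.sdiff_subset ?_
  · exact (this.symm.subset hx).2 rfl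
  refine h.update Set.sdiff_subset hcB ?_ hsub ?_ ?_ ?_ ?_
  · intro l
    by_cases hli : l = i
    · subst hli
      rw [Function.update_self]
      exact (h.connA l).cons ha e.symm
    · rw [Function.update_of_ne hli]
      exact h.connA l
  · intro l m hlm y hy z hz
    rcases hmem l y hy with hy' | ⟨rfl, rfl⟩ <;> rcases hmem m z hz with hz' | ⟨rfl, rfl⟩
    · exact h.antiA l m hlm y hy' z hz'
    · exact ⟨fun hyz => h.disj l j y hy' (hyz ▸ hx), hl l hlm y hy'⟩
    · exact ⟨fun hyz => h.disj m j z hz' (hyz ▸ hx), fun e => hl m hlm.symm z hz' e.symm⟩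
    · exact absurd rfl hlm
  · intro l m hm y hy
    rcases hmem l y hy with hy | ⟨rfl, rfl⟩
    · exact h.disj l m y hy
    · exact fun hym => (h.antiB m j hm y hym y hx).1 rfl
  · rintro l y hy ⟨hyB, hyx⟩
    rcases hmem l y hy with hy | ⟨rfl, rfl⟩
    · exact h.disj l j y hy hyB
    · exact hyx rfl
  · intro l
    by_cases hli : l = i
    · subst hli
      rw [Function.update_self]
      obtain ⟨w, hw⟩ := hcB.1
      obtain ⟨p, -, hp, q, hq, hqx, hpq⟩ :=
        (h.connB j).exists_adj (T := {x}) ⟨x, hx, rfl⟩ ⟨w, hw.1, hw.2⟩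
      obtain rfl : p = x := hp
      exact ⟨p, Or.inl rfl, q, ⟨hq, hqx⟩, hpq⟩
    · rw [Function.update_of_ne hli]
      obtain ⟨b, hb, y, hy, hby⟩ := h.sees l j
      refine ⟨b, hb, y, ⟨hy, fun hyx => ?_⟩, hby⟩
      exact hl l hli b hb (Set.mem_singleton_iff.1 hyx ▸ hby)

theorem MinModel.small_or_large [Finite V] {A : Fin 3 → Set V} {B : Fin 4 → Set V}
    (h : G.MinModel A B) (j : Fin 4) : G.Small (B j) ∨ ∃ f e, G.Large A (B j) f e := by
  by_cases h1 : ∃ v, B j = {v}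
  · obtain ⟨v, hv⟩ := h1
    exact Or.inl (hv ▸ small_singleton v)
  push Not at h1
  obtain ⟨c, hc, d, hd, hcd, hBc, hBd⟩ := (h.connB j).exists_two h1
  obtain ⟨i, hic, hi, l, hli, hlc⟩ := h.noncut hc hBc
  obtain ⟨k, hkd, hk, m, hmk, hmd⟩ := h.noncut hd hBd
  have hik : i ≠ k := by
    rintro rfl
    obtain ⟨a, ha, e⟩ := hic
    exact hcd (hk a ha c hc e)
  have hlk : l ≠ k := by
    rintro rfl
    obtain ⟨a, ha, e⟩ := hlc
    exact hcd (hk a ha c hc e)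
  have hmi : m ≠ i := by
    rintro rfl
    obtain ⟨a, ha, e⟩ := hmd
    exact hcd (hi a ha d hd e).symm
  -- Both differ from `i` and `k`, so the third set sees `c` and `d`. Any connected part of `B j`
  -- containing `c` and `d` is therefore all of `B j`.
  obtain rfl : m = l := by omega
  have hsee : ∀ Z : Set V, c ∈ Z → d ∈ Z → ∀ n, G.Sees (A n) Z := by
    intro Z hcZ hdZ
    refine forall3 hmi.symm hik hmk ?_ ?_ ?_
    · obtain ⟨a, ha, e⟩ := hic
      exact ⟨a, ha, c, hcZ, e⟩
    · obtain ⟨a, ha, e⟩ := hmd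
      exact ⟨a, ha, d, hdZ, e⟩
    · obtain ⟨a, ha, e⟩ := hkd
      exact ⟨a, ha, d, hdZ, e⟩
  by_cases hadj : G.Adj c d
  · left
    rw [← h.eq_of_subset (Z := {c, d}) (by simp [Set.insert_subset_iff, hc, hd]) (conn_pair hadj)
      (hsee _ (by simp) (by simp))]
    exact small_pair hadj
  right
  -- The value at `m` is a dummy: `Large` constrains `e` only away from the kind `m`.
  obtain ⟨e, hei, -, hek⟩ := exists_fun3 hmi.symm hik hmk c c d
  have hcases : ∀ {p : Fin 3 → Prop}, p i → p k → ∀ n, n ≠ m → p n := by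
    intro p hi hk n hn
    rcases fin3_cases hmi.symm hik hmk n with rfl | rfl | rfl
    · exact hi
    · exact absurd rfl hn
    · exact hk
  refine ⟨m, e, hcases (hei ▸ hc) (hek ▸ hd), hcases (hei ▸ hic) (hek ▸ hkd),
    hcases (hei ▸ hi) (hek ▸ hk), hcases (hei ▸ hlc) (hek ▸ hmd), ?_, ?_⟩
  · intro a b ha hb
    revert a b
    have h1 : ∀ b, b ≠ m → i ≠ b → e i ≠ e b ∧ ¬ G.Adj (e i) (e b) :=
      hcases (fun h => absurd rfl h) (fun _ => by rw [hei, hek]; exact ⟨hcd, hadj⟩)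
    have h2 : ∀ b, b ≠ m → k ≠ b → e k ≠ e b ∧ ¬ G.Adj (e k) (e b) :=
      hcases (fun _ => by rw [hei, hek]; exact ⟨hcd.symm, fun h => hadj h.symm⟩)
        (fun h => absurd rfl h)
    exact fun a b ha hb => hcases (p := fun a => a ≠ b → e a ≠ e b ∧ ¬ G.Adj (e a) (e b))
      (h1 b hb) (h2 b hb) a ha
  · intro Z hZ hZc hZe
    exact h.eq_of_subset hZ hZc
      (hsee Z (hei ▸ hZe i hmi.symm) (hek ▸ hZe k hmk.symm))

/-! ### Forks and centers -/

/-- `v` sends two separate connected branches inside `X`, one to `C` and one to `D`. -/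
def Forks (G : SimpleGraph V) (X C D : Set V) (v : V) : Prop :=
  ∃ S T : Set V, S ⊆ X ∧ T ⊆ X ∧ G.Conn S ∧ G.Conn T ∧ (∃ y ∈ S, G.Adj v y) ∧
    (∃ y ∈ T, G.Adj v y) ∧ G.Sees C S ∧ G.Sees D T ∧ G.Anti S T ∧ ¬ G.Sees D S ∧ ¬ G.Sees C T

theorem Fan.forks {X : Set V} {C : Fin 3 → Set V} {i j k : Fin 3} {v : V} (h : G.Fan X C j v)
    (hi : i ≠ j) (hk : k ≠ j) (hik : i ≠ k) : G.Forks X (C i) (C k) v := by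
  obtain ⟨S, h1, h2⟩ := h
  exact ⟨S i, S k, (h1 i hi).1, (h1 k hk).1, (h1 i hi).2.1, (h1 k hk).2.1, (h1 i hi).2.2.1,
    (h1 k hk).2.2.1, (h1 i hi).2.2.2, (h1 k hk).2.2.2, (h2 i k hi hk hik).1,
    (h2 i k hi hk hik).2, (h2 k i hk hi hik.symm).2⟩

theorem Forks.exists_two {X C D : Set V} {v : V} (h : G.Forks X C D v) :
    ∃ y ∈ X, ∃ z ∈ X, G.Adj v y ∧ G.Adj v z ∧ y ≠ z := by
  obtain ⟨S, T, h1, h2, -, -, ⟨y, hy, e⟩, ⟨z, hz, e'⟩, -, -, h9, -, -⟩ := h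
  exact ⟨y, h1 hy, z, h2 hz, e, e', (h9 y hy z hz).1⟩

theorem Forks.exists_adj {X C D : Set V} {v : V} (h : G.Forks X C D v) : ∃ y ∈ X, G.Adj v y := by
  obtain ⟨y, hy, -, -, e, -, -⟩ := h.exists_two
  exact ⟨y, hy, e⟩

/-- The standard exclusion of centers: separate branches of a fork need distinct neighbours of `v`.
-/
theorem Forks.false_of_unique {X C D : Set V} {v w : V} (h : G.Forks X C D v)
    (hu : ∀ y ∈ X, G.Adj v y → y = w) : False := by
  obtain ⟨y, hy, z, hz, e, e', hne⟩ := h.exists_two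
  exact hne ((hu y hy e).trans (hu z hz e').symm)

theorem Small.not_forks {X C D : Set V} {v : V} (hX : G.Small X) : ¬ G.Forks X C D v := by
  rintro ⟨S, T, h1, h2, h3, h4, -, -, -, -, h9, -, -⟩
  exact hX S h1 T h2 h3.1 h4.1 h9

/-- The connector `C` contains an obstruction to the linkage of `X` and `X'` by `C`, `D`, `E`. -/
def IsCenter (G : SimpleGraph V) (X X' C D E : Set V) : Prop :=
  ∃ v ∈ C, (G.Forks X D E v ∧ ∃ x ∈ X', G.Adj v x) ∨ (G.Forks X' D E v ∧ ∃ x ∈ X, G.Adj v x) ∨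
    ∃ v' ∈ C, G.Adj v v' ∧ G.Forks X D E v ∧ G.Forks X' D E v'

theorem IsCenter.small_left {X X' C D E : Set V} (h : G.IsCenter X X' C D E) (hX : G.Small X) :
    ∃ v ∈ C, G.Forks X' D E v ∧ ∃ x ∈ X, G.Adj v x := by
  obtain ⟨v, hv, ⟨h, -⟩ | h | ⟨v', -, -, h, -⟩⟩ := h
  · exact absurd h hX.not_forks
  · exact ⟨v, hv, h⟩
  · exact absurd h hX.not_forks

/-- A center yields two equal or adjacent vertices of the connector, one with a neighbour in `X`,
the other with a neighbour in `X'`. -/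
theorem IsCenter.exists_adj {X X' C D E : Set V} (h : G.IsCenter X X' C D E) :
    ∃ v ∈ C, ∃ v' ∈ C, (v = v' ∨ G.Adj v v') ∧ (∃ x ∈ X, G.Adj v x) ∧ ∃ x ∈ X', G.Adj v' x := by
  obtain ⟨v, hv, ⟨h, h'⟩ | ⟨h, h'⟩ | ⟨v', hv', e, h, h'⟩⟩ := h
  · exact ⟨v, hv, v, hv, Or.inl rfl, h.exists_adj, h'⟩
  · exact ⟨v, hv, v, hv, Or.inl rfl, h', h.exists_adj⟩
  · exact ⟨v, hv, v', hv', Or.inr e, h.exists_adj, h'.exists_adj⟩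

/-- `X` and `X'` are separate connected sets, and `C` is a connected set disjoint from and seeing
both. -/
structure Connects (G : SimpleGraph V) (X X' C : Set V) : Prop where
  conn : G.Conn C
  disj : ∀ x ∈ C, x ∉ X
  disj' : ∀ x ∈ C, x ∉ X'
  sees : G.Sees C X
  sees' : G.Sees C X'

theorem hasConfig_or_isCenter [Finite V] {X X' C D E : Set V} (hX : G.Conn X) (hX' : G.Conn X')
    (hXX' : G.Anti X X') (hC : G.Connects X X' C) (hD : G.Connects X X' D)
    (hE : G.Connects X X' E) (hCD : G.Anti C D) (hCE : G.Anti C E) (hDE : G.Anti D E) :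
    G.HasConfig ∨ G.IsCenter X X' C D E ∨ G.IsCenter X X' D C E ∨ G.IsCenter X X' E C D := by
  have h01 : (0 : Fin 3) ≠ 1 := by decide
  have h02 : (0 : Fin 3) ≠ 2 := by decide
  have h12 : (1 : Fin 3) ≠ 2 := by decide
  obtain ⟨F, hF0, hF1, hF2⟩ := exists_fun3 h01 h02 h12 C D E
  have hF : ∀ i, G.Connects X X' (F i) := forall3 h01 h02 h12 (hF0 ▸ hC) (hF1 ▸ hD) (hF2 ▸ hE)
  refine (hasConfig_or_hasCenter (C := F) hX hX' hXX' (fun i => (hF i).conn)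
    (forall3_pair h01 h02 h12 (fun _ _ h => h.symm) (by rwa [hF0, hF1]) (by rwa [hF0, hF2])
      (by rwa [hF1, hF2])) (fun i x hx => ⟨(hF i).disj x hx, (hF i).disj' x hx⟩)
    (fun i => ⟨(hF i).sees, (hF i).sees'⟩)).imp_right ?_
  have key : ∀ j, ∀ v ∈ F j, ((G.Fan X F j v ∧ ∃ x ∈ X', G.Adj v x) ∨
      (G.Fan X' F j v ∧ ∃ x ∈ X, G.Adj v x) ∨
      ∃ v' ∈ F j, G.Adj v v' ∧ G.Fan X F j v ∧ G.Fan X' F j v') → ∀ i k, i ≠ j → k ≠ j → i ≠ k →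
      G.IsCenter X X' (F j) (F i) (F k) := by
    intro j v hv h i k hij hkj hik
    refine ⟨v, hv, ?_⟩
    rcases h with ⟨h1, h2⟩ | ⟨h1, h2⟩ | ⟨v', h0, h1, h2, h3⟩
    · exact Or.inl ⟨h1.forks hij hkj hik, h2⟩
    · exact Or.inr (Or.inl ⟨h1.forks hij hkj hik, h2⟩)
    · exact Or.inr (Or.inr ⟨v', h0, h1, h2.forks hij hkj hik, h3.forks hij hkj hik⟩)
  rintro ⟨j, v, hv, h⟩
  rcases fin3_cases h01 h02 h12 j with rfl | rfl | rfl
  · have := key _ v hv h 1 2 h01.symm h02.symm h12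
    rw [hF0, hF1, hF2] at this
    exact Or.inl this
  · have := key _ v hv h 0 2 h01 h12.symm h02
    rw [hF0, hF1, hF2] at this
    exact Or.inr (Or.inl this)
  · have := key _ v hv h 0 1 h02 h12 h01
    rw [hF0, hF1, hF2] at this
    exact Or.inr (Or.inr this)

/-! ### Two small sets, or two large sets of the same kind -/

namespace Model

variable {A : Fin 3 → Set V} {B : Fin 4 → Set V}

theorem connects_A (h : G.Model A B) (i : Fin 3) (j l : Fin 4) :
    G.Connects (B j) (B l) (A i) :=
  ⟨h.connA i, h.disj i j, h.disj i l, h.sees i j, h.sees i l⟩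

theorem connects_B (h : G.Model A B) (i k : Fin 3) (j : Fin 4) :
    G.Connects (A i) (A k) (B j) :=
  ⟨h.connB j, fun x hx hA => h.disj i j x hA hx, fun x hx hA => h.disj k j x hA hx,
    (h.sees i j).symm, (h.sees k j).symm⟩

theorem hasConfig_of_small_small [Finite V] (h : G.Model A B) {j l : Fin 4} (hjl : j ≠ l)
    (hj : G.Small (B j)) (hl : G.Small (B l)) : G.HasConfig := by
  have hc : ∀ {C D E : Set V}, ¬ G.IsCenter (B j) (B l) C D E := fun hc => by
    obtain ⟨v, -, h, -⟩ := hc.small_left hj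
    exact hl.not_forks h
  have := hasConfig_or_isCenter (h.connB j) (h.connB l) (h.antiB j l hjl) (h.connects_A 0 j l)
    (h.connects_A 1 j l) (h.connects_A 2 j l) (h.antiA 0 1 (by decide)) (h.antiA 0 2 (by decide))
    (h.antiA 1 2 (by decide))
  rcases this with this | this | this | this
  · exact this
  all_goals exact absurd this hc

end Model

/-- A center would make the two ends of `B` equal or adjacent. -/
theorem Large.not_isCenter {A : Fin 3 → Set V} {B : Set V} {f i k : Fin 3} {e : Fin 3 → V}
    (h : G.Large A B f e) (hi : i ≠ f) (hk : k ≠ f) (hik : i ≠ k) {D E : Set V} :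
    ¬ G.IsCenter (A i) (A k) B D E := by
  intro hc
  obtain ⟨v, hv, v', hv', hvv', ⟨a, ha, hva⟩, b, hb, hvb⟩ := hc.exists_adj
  have h1 := h.uniq i hi a ha v hv hva.symm
  have h2 := h.uniq k hk b hb v' hv' hvb.symm
  have := h.anti i k hi hk hik
  rw [← h1, ← h2] at this
  tauto

/-- The set `{x}` is linked to `A f ∪ B j₂` by `S` with the end `e₁ m`, by `T`, and by `A n`. A
center would have to be a neighbour of `x` forking in `A f ∪ B j₂`. But `e₁ m` is not adjacent to
`x`, and vertices of `A m` or `A n` see at most one vertex of that union, an end of `B j₂`. -/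
theorem Model.hasConfig_of_forks [Finite V] {A : Fin 3 → Set V} {B : Fin 4 → Set V}
    (h : G.Model A B) {j₁ j₂ j₃ : Fin 4} (h12 : j₁ ≠ j₂) (h13 : j₁ ≠ j₃) (h23 : j₂ ≠ j₃)
    {f m n : Fin 3} (hmf : m ≠ f) (hnf : n ≠ f) (hmn : m ≠ n) {e₁ e₂ : Fin 3 → V}
    (H₁ : G.Large A (B j₁) f e₁) (H₂ : G.Large A (B j₂) f e₂) {x : V} (hx : x ∈ B j₃)
    (hxf : ∀ a ∈ A f, ¬ G.Adj x a) (hxn : ∃ a ∈ A n, G.Adj x a)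
    (hfork : G.Forks (A m) (B j₁) (B j₂) x) : G.HasConfig := by
  obtain ⟨S, T, hSA, hTA, hS, hT, hxS, hxT, hBS, hBT, hST, hBS', hBT'⟩ := hfork
  have heS : ∃ y ∈ S, G.Adj (e₁ m) y := by
    obtain ⟨b, hb, y, hy, hby⟩ := hBS
    obtain rfl := H₁.uniq m hmf y (hSA hy) b hb hby.symm
    exact ⟨y, hy, hby⟩
  obtain ⟨s, hs, hes⟩ := heS
  have hme := H₁.mem m hmf
  have hfB : G.Conn (A f ∪ B j₂) := (h.connA f).union (h.connB j₂) (h.sees f j₂)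
  have hAf : ∀ i, i ≠ f → ∀ z ∈ A i, z ∉ A f ∪ B j₂ := by
    rintro i hi z hz (hz' | hz')
    · exact (h.antiA i f hi z hz z hz').1 rfl
    · exact h.disj i j₂ z hz hz'
  have hnbr : ∀ i, i ≠ f → ∀ z ∈ A i, ∀ y ∈ A f ∪ B j₂, G.Adj z y → y = e₂ i := by
    rintro i hi z hz y (hy | hy) hzy
    · exact absurd hzy (h.antiA i f hi z hz y hy).2
    · exact H₂.uniq i hi z hz y hy hzy
  have hxA : ∀ i, ∀ z ∈ A i, z ∉ ({x} : Set V) := by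
    rintro i z hz rfl
    exact h.disj i j₃ z hz hx
  have hcon0 : G.Connects {x} (A f ∪ B j₂) (insert (e₁ m) S) := by
    refine ⟨hS.cons hs hes, ?_, ?_, ?_, ?_⟩
    · rintro z (rfl | hz)
      · exact fun hzx => (h.antiB _ _ h13 _ hme x hx).1 hzx
      · exact hxA m z (hSA hz)
    · rintro z (rfl | hz)
      · rintro (hz' | hz')
        · exact h.disj f j₁ _ hz' hme
        · exact (h.antiB _ _ h12 _ hme _ hz').1 rfl
      · exact hAf m hmf z (hSA hz)
    · obtain ⟨y, hy, hxy⟩ := hxS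
      exact ⟨y, Or.inr hy, x, rfl, hxy.symm⟩
    · obtain ⟨a, ha, hae⟩ := H₁.adjf m hmf
      exact ⟨_, Or.inl rfl, a, Or.inl ha, hae.symm⟩
  have hcon1 : G.Connects {x} (A f ∪ B j₂) T := by
    refine ⟨hT, fun z hz => hxA m z (hTA hz), fun z hz => hAf m hmf z (hTA hz), ?_, ?_⟩
    · obtain ⟨y, hy, hxy⟩ := hxT
      exact ⟨y, hy, x, rfl, hxy.symm⟩
    · exact hBT.symm.mono subset_rfl Set.subset_union_right
  have hcon2 : G.Connects {x} (A f ∪ B j₂) (A n) := by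
    refine ⟨h.connA n, hxA n, hAf n hnf, ?_, ?_⟩
    · obtain ⟨y, hy, hxy⟩ := hxn
      exact ⟨y, hy, x, rfl, hxy.symm⟩
    · exact (h.sees n j₂).mono subset_rfl Set.subset_union_right
  have hanti : G.Anti {x} (A f ∪ B j₂) := by
    rintro y hyx z hz
    obtain rfl : y = x := hyx
    rcases hz with hz | hz
    · exact ⟨fun hyz => h.disj f j₃ z hz (hyz ▸ hx), hxf z hz⟩
    · exact h.antiB _ _ h23.symm y hx z hz
  have h01 : G.Anti (insert (e₁ m) S) T := by
    rintro y (rfl | hy) z hz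
    · exact ⟨fun hyz => h.disj m j₁ z (hTA hz) (hyz ▸ hme), fun hyz => hBT' ⟨_, hme, z, hz, hyz⟩⟩
    · exact hST y hy z hz
  have h02 : G.Anti (insert (e₁ m) S) (A n) := by
    rintro y (rfl | hy) z hz
    · refine ⟨fun hyz => h.disj n j₁ z hz (hyz ▸ hme), fun hyz => ?_⟩
      exact (H₁.anti m n hmf hnf hmn).1 (H₁.uniq n hnf z hz _ hme hyz.symm)
    · exact h.antiA m n hmn y (hSA hy) z hz
  have h12 : G.Anti T (A n) := (h.antiA m n hmn).mono hTA subset_rfl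
  rcases hasConfig_or_isCenter (conn_singleton x) hfB hanti hcon0 hcon1 hcon2 h01 h02 h12 with
    hc | hc | hc | hc
  · exact hc
  · obtain ⟨v, hv, hF, y, hyx, hvx⟩ := hc.small_left (small_singleton x)
    obtain rfl : y = x := hyx
    rcases hv with rfl | hv
    · exact absurd hvx (h.antiB _ _ h13 _ hme y hx).2
    · exact (hF.false_of_unique (hnbr m hmf v (hSA hv))).elim
  · obtain ⟨v, hv, hF, -⟩ := hc.small_left (small_singleton x)
    exact (hF.false_of_unique (hnbr m hmf v (hTA hv))).elim
  · obtain ⟨v, hv, hF, -⟩ := hc.small_left (small_singleton x)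
    exact (hF.false_of_unique (hnbr n hnf v hv)).elim

/-- Three large sets, two of them of the same kind, yield a 3-path configuration. -/
theorem Model.hasConfig_of_same [Finite V] {A : Fin 3 → Set V} {B : Fin 4 → Set V}
    (h : G.Model A B) {j₁ j₂ j₃ : Fin 4} (h12 : j₁ ≠ j₂) (h13 : j₁ ≠ j₃) (h23 : j₂ ≠ j₃)
    {f g : Fin 3} {e₁ e₂ e₃ : Fin 3 → V} (H₁ : G.Large A (B j₁) f e₁)
    (H₂ : G.Large A (B j₂) f e₂) (H₃ : G.Large A (B j₃) g e₃) : G.HasConfig := by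
  -- The indices other than `f` are ordered so that `k ≠ g`. Thus `A k` has a single attachment in
  -- `B j₃`.
  obtain ⟨i, k, hif, hkf, hik, hgk⟩ : ∃ i k, i ≠ f ∧ k ≠ f ∧ i ≠ k ∧ (g = f ∨ g = i) := by
    clear H₁ H₂ H₃
    revert f g
    decide
  rcases hasConfig_or_isCenter (h.connA i) (h.connA k) (h.antiA i k hik) (h.connects_B i k j₁)
    (h.connects_B i k j₂) (h.connects_B i k j₃) (h.antiB _ _ h12) (h.antiB _ _ h13)
    (h.antiB _ _ h23) with hc | hc | hc | hc
  · exact hc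
  · exact absurd hc (H₁.not_isCenter hif hkf hik)
  · exact absurd hc (H₂.not_isCenter hif hkf hik)
  rcases hgk with rfl | rfl
  · exact absurd hc (H₃.not_isCenter hif hkf hik)
  -- The center or its partner sees `A k`, so it is the end `e₃ k`. This vertex also sees `A g`, but
  -- not `A f`, which is attached at the other end.
  have hx := H₃.mem k hik.symm
  have hxf : ∀ a ∈ A f, ¬ G.Adj (e₃ k) a := fun a ha e =>
    (H₃.anti k f hik.symm hif.symm hkf).1 (H₃.uniq f hif.symm a ha _ hx e.symm)
  have hxg : ∃ a ∈ A g, G.Adj (e₃ k) a := by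
    obtain ⟨a, ha, e⟩ := H₃.adjf k hik.symm
    exact ⟨a, ha, e.symm⟩
  have hxk : ∃ a ∈ A k, G.Adj (e₃ k) a := by
    obtain ⟨a, ha, e⟩ := H₃.adj k hik.symm
    exact ⟨a, ha, e.symm⟩
  have hu : ∀ v ∈ B j₃, (∃ a ∈ A k, G.Adj v a) → v = e₃ k := by
    rintro v hv ⟨a, ha, e⟩
    exact H₃.uniq k hik.symm a ha v hv e.symm
  obtain ⟨v, hv, ⟨hF, hs⟩ | ⟨hF, -⟩ | ⟨v', hv', -, -, hF⟩⟩ := hc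
  · rw [hu v hv hs] at hF
    exact h.hasConfig_of_forks h12 h13 h23 hif hkf hik H₁ H₂ hx hxf hxk hF
  · rw [hu v hv hF.exists_adj] at hF
    exact h.hasConfig_of_forks h12 h13 h23 hkf hif hik.symm H₁ H₂ hx hxf hxg hF
  · rw [hu v' hv' hF.exists_adj] at hF
    exact h.hasConfig_of_forks h12 h13 h23 hkf hif hik.symm H₁ H₂ hx hxf hxg hF

theorem anti_of_not_sees {S T : Set V} (h : ∀ x ∈ S, x ∉ T) (h' : ¬ G.Sees S T) : G.Anti S T :=
  fun x hx y hy => ⟨fun e => h x hx (e ▸ hy), fun e => h' ⟨x, hx, y, hy, e⟩⟩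

theorem not_isCenter_of_unique {X X' C D E : Set V} {w w' : V}
    (h : ∀ v ∈ C, ∀ y ∈ X, G.Adj v y → y = w) (h' : ∀ v ∈ C, ∀ y ∈ X', G.Adj v y → y = w') :
    ¬ G.IsCenter X X' C D E := by
  rintro ⟨v, hv, ⟨hF, -⟩ | ⟨hF, -⟩ | ⟨-, -, -, hF, -⟩⟩
  · exact hF.false_of_unique (h v hv)
  · exact hF.false_of_unique (h' v hv)
  · exact hF.false_of_unique (h v hv)

/-! ### One small set and three large sets of different kinds -/

/-- Three large sets of different kinds and a small set. -/
structure MixedModel (G : SimpleGraph V) (A D : Fin 3 → Set V) (S : Set V)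
    (e : Fin 3 → Fin 3 → V) : Prop where
  connA : ∀ i, G.Conn (A i)
  connD : ∀ i, G.Conn (D i)
  connS : G.Conn S
  antiA : ∀ i k, i ≠ k → G.Anti (A i) (A k)
  antiD : ∀ i k, i ≠ k → G.Anti (D i) (D k)
  antiS : ∀ i, G.Anti S (D i)
  disjD : ∀ i k, ∀ x ∈ A i, x ∉ D k
  disjS : ∀ i, ∀ x ∈ A i, x ∉ S
  seesD : ∀ i k, G.Sees (A i) (D k)
  seesS : ∀ i, G.Sees (A i) S
  small : G.Small S
  large : ∀ i, G.Large A (D i) i (e i)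

/-- `Y` is a connected part of `A k` joining the end `e i k` of `D i` to the end `e k i` of `D k`
and seeing nothing else of `D k`. -/
structure IsEndLink (G : SimpleGraph V) (A D : Fin 3 → Set V) (e : Fin 3 → Fin 3 → V)
    (i k : Fin 3) (Y : Set V) : Prop where
  sub : Y ⊆ A k
  conn : G.Conn Y
  adj : ∃ y ∈ Y, G.Adj (e i k) y
  sees : G.Sees Y (D k)
  uniq : ∀ y ∈ Y, ∀ x ∈ D k, G.Adj y x → x = e k i

namespace MixedModel

variable {A D : Fin 3 → Set V} {S : Set V} {e : Fin 3 → Fin 3 → V}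

theorem uniq (H : G.MixedModel A D S e) {i k : Fin 3} (hik : i ≠ k) {a x : V} (ha : a ∈ A k)
    (hx : x ∈ D i) (h : G.Adj a x) : x = e i k :=
  (H.large i).uniq k hik.symm a ha x hx h

theorem mem (H : G.MixedModel A D S e) {i k : Fin 3} (hik : i ≠ k) : e i k ∈ D i :=
  (H.large i).mem k hik.symm

theorem adj (H : G.MixedModel A D S e) {i k : Fin 3} (hik : i ≠ k) : ∃ a ∈ A k, G.Adj (e i k) a := by
  obtain ⟨a, ha, h⟩ := (H.large i).adj k hik.symm
  exact ⟨a, ha, h.symm⟩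

theorem end_mem_of_sees (H : G.MixedModel A D S e) {i k : Fin 3} (hik : i ≠ k) {Y R : Set V}
    (hY : Y ⊆ A k) (hR : R ⊆ D i) (h : G.Sees Y R) : e i k ∈ R := by
  obtain ⟨y, hy, x, hx, hyx⟩ := h
  rwa [← H.uniq hik (hY hy) (hR hx) hyx]

theorem connects (H : G.MixedModel A D S e) {i k l : Fin 3} {Y : Set V} (hY : Y ⊆ A l)
    (hc : G.Conn Y) (h1 : G.Sees Y (D i)) (h2 : G.Sees Y (D k)) : G.Connects (D i) (D k) Y :=
  ⟨hc, fun x hx => H.disjD l i x (hY hx), fun x hx => H.disjD l k x (hY hx), h1, h2⟩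

theorem connectsS (H : G.MixedModel A D S e) {k l : Fin 3} {Y : Set V} (hY : Y ⊆ A l)
    (hc : G.Conn Y) (h1 : G.Sees Y S) (h2 : G.Sees Y (D k)) : G.Connects S (D k) Y :=
  ⟨hc, fun x hx => H.disjS l x (hY hx), fun x hx => H.disjD l k x (hY hx), h1, h2⟩

/-- Otherwise `Y`, `A i`, `A j` link `S` to `D k`. No fork fits in `S`, and each of the three has a
single attachment in `D k`. -/
theorem bridge_not_sees_small [Finite V] (H : G.MixedModel A D S e) (hn : ¬ G.HasConfig)
    {i k : Fin 3} (hik : i ≠ k) {Y : Set V} (hY : G.IsEndLink A D e i k Y) : ¬ G.Sees Y S := by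
  intro hs
  obtain ⟨j, hij, hjk⟩ := exists_third hik
  rcases hasConfig_or_isCenter H.connS (H.connD k) (H.antiS k) (H.connectsS hY.sub hY.conn hs hY.sees)
    (H.connectsS subset_rfl (H.connA i) (H.seesS i) (H.seesD i k))
    (H.connectsS subset_rfl (H.connA j) (H.seesS j) (H.seesD j k))
    ((H.antiA k i hik.symm).mono hY.sub subset_rfl) ((H.antiA k j hjk.symm).mono hY.sub subset_rfl)
    (H.antiA i j hij) with hc | hc | hc | hc
  · exact hn hc
  · obtain ⟨v, hv, hF, -⟩ := hc.small_left H.small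
    exact hF.false_of_unique (hY.uniq v hv)
  · obtain ⟨v, hv, hF, -⟩ := hc.small_left H.small
    exact hF.false_of_unique fun y hy h => H.uniq hik.symm hv hy h
  · obtain ⟨v, hv, hF, -⟩ := hc.small_left H.small
    exact hF.false_of_unique fun y hy h => H.uniq hjk.symm hv hy h

/-- Otherwise `Y`, `W`, `A i` link `D j` to `D k`, each with a single attachment on either side, so
there is no center. -/
theorem bridge_not_adj_end [Finite V] (H : G.MixedModel A D S e) (hn : ¬ G.HasConfig)
    {i j k : Fin 3} (hij : i ≠ j) (hik : i ≠ k) (hjk : j ≠ k) {Y W : Set V}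
    (hY : G.IsEndLink A D e i j Y) (hW : G.IsEndLink A D e j k W) :
    ∀ y ∈ Y, ¬ G.Adj y (e k j) := by
  intro y hy hadj
  rcases hasConfig_or_isCenter (H.connD j) (H.connD k) (H.antiD j k hjk)
    (H.connects hY.sub hY.conn hY.sees ⟨y, hy, _, H.mem hjk.symm, hadj⟩)
    (H.connects hW.sub hW.conn (by
      obtain ⟨w, hw, h⟩ := hW.adj
      exact ⟨w, hw, _, H.mem hjk, h.symm⟩) hW.sees)
    (H.connects subset_rfl (H.connA i) (H.seesD i j) (H.seesD i k))
    ((H.antiA j k hjk).mono hY.sub hW.sub) ((H.antiA j i hij.symm).mono hY.sub subset_rfl)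
    ((H.antiA k i hik.symm).mono hW.sub subset_rfl) with hc | hc | hc | hc
  · exact hn hc
  · exact not_isCenter_of_unique hY.uniq
      (fun v hv x hx h => H.uniq hjk.symm (hY.sub hv) hx h) hc
  · exact not_isCenter_of_unique (fun v hv x hx h => H.uniq hjk (hW.sub hv) hx h) hW.uniq hc
  · exact not_isCenter_of_unique (fun v hv x hx h => H.uniq hij.symm hv hx h)
      (fun v hv x hx h => H.uniq hik.symm hv hx h) hc

/-- Link `S` to `D i` by the three sets `A l`. A center must fork in `D i`, and only vertices of `A
i` may have two neighbours there. -/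
theorem exists_forks [Finite V] (H : G.MixedModel A D S e) (hn : ¬ G.HasConfig)
    {i j k : Fin 3} (hij : i ≠ j) (hik : i ≠ k) (hjk : j ≠ k) :
    ∃ v ∈ A i, G.Forks (D i) (A j) (A k) v ∧ ∃ x ∈ S, G.Adj v x := by
  have hcon : ∀ l, G.Connects S (D i) (A l) := fun l =>
    H.connectsS subset_rfl (H.connA l) (H.seesS l) (H.seesD l i)
  rcases hasConfig_or_isCenter H.connS (H.connD i) (H.antiS i) (hcon i) (hcon j) (hcon k)
    (H.antiA i j hij) (H.antiA i k hik) (H.antiA j k hjk) with hc | hc | hc | hc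
  · exact absurd hc hn
  · exact hc.small_left H.small
  · obtain ⟨v, hv, hF, -⟩ := hc.small_left H.small
    exact (hF.false_of_unique fun y hy h => H.uniq hij hv hy h).elim
  · obtain ⟨v, hv, hF, -⟩ := hc.small_left H.small
    exact (hF.false_of_unique fun y hy h => H.uniq hik hv hy h).elim

/-- A fork at a neighbour of `e k i` forces a minimal link from `e i k` to `D k` to be a bridge. -/
theorem isEndLink_of_forks [Finite V] (H : G.MixedModel A D S e) (hn : ¬ G.HasConfig)
    {i j k : Fin 3} (hij : i ≠ j) (hik : i ≠ k) (hjk : j ≠ k) {Y : Set V} (hYA : Y ⊆ A k)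
    (hY : G.Conn Y) {p t : V} (hp : p ∈ Y) (hep : G.Adj (e i k) p) (ht : t ∈ Y)
    (hts : ∃ x ∈ D k, G.Adj t x) (htu : ∀ y ∈ Y, ∀ x ∈ D k, G.Adj y x → y = t)
    (hYt : Y = {t} ∨ (p ≠ t ∧ G.Conn (Y \ {t}))) {v : V} (hv : v ∈ A i)
    (hve : G.Adj v (e k i)) (hF : G.Forks (D i) Y (A j) v) : G.IsEndLink A D e i k Y := by
  refine ⟨hYA, hY, ⟨p, hp, hep⟩, ?_, ?_⟩
  · obtain ⟨x, hx, h⟩ := hts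
    exact ⟨t, ht, x, hx, h⟩
  intro y hy x hx hyx
  obtain rfl := htu y hy x hx hyx
  -- If `y` also sees some `x ≠ e k i` in `D k`, then `{v}` is linked to `D k \ {e k i} ∪ {y}` by
  -- `{e k i}`, by `R` with the rest of `Y`, and by `T` with `A j`. It remains to exclude centers.
  by_contra hne
  refine hn ?_
  obtain ⟨R, T, hRD, hTD, hR, hT, ⟨r, hr, hvr⟩, ⟨u, hu, hvu⟩, hYR, hAT, hRT, hAR, hYT⟩ := hF
  have heR : e i k ∈ R := H.end_mem_of_sees hik hYA hRD hYR
  have heT : e i j ∈ T := H.end_mem_of_sees hij subset_rfl hTD hAT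
  have hends := (H.large k).anti i j hik hjk hij
  have hcases : ∀ n, n ≠ k → n = i ∨ n = j := by
    intro n hn
    rcases fin3_cases hij hik hjk n with h | h | h <;> tauto
  have hkmin : ∀ Z ⊆ D k, G.Conn Z → e k i ∈ Z → e k j ∈ Z → Z = D k := by
    intro Z hZ hZc h1 h2
    refine (H.large k).min Z hZ hZc fun n hn => ?_
    rcases hcases n hn with rfl | rfl <;> assumption
  have hDk : G.Conn (D k \ {e k i}) :=
    (H.connD k).diff_of_minimal (H.mem hjk.symm) (H.mem hik.symm) hends.1.symm
      fun Z hZ hZc h1 h2 => hkmin Z hZ hZc h2 h1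
  have hX' : G.Conn (D k \ {e k i} ∪ {y}) :=
    hDk.union (conn_singleton y) ⟨x, ⟨hx, hne⟩, y, rfl, hyx.symm⟩
  have hvD : ∀ z ∈ D k, G.Adj v z → z = e k i := fun z hz h => H.uniq hik.symm hv hz h
  have hanti : G.Anti {v} (D k \ {e k i} ∪ {y}) := by
    rintro w hwv z (⟨hz, hze⟩ | hz)
    · obtain rfl : w = v := hwv
      exact ⟨fun h => H.disjD i k w hv (h ▸ hz), fun h => hze (hvD z hz h)⟩
    · obtain rfl : w = v := hwv
      obtain rfl : z = y := hz
      exact H.antiA i k hik w hv z (hYA hy)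
  have hvy := H.antiA i k hik v hv
  have hcon0 : G.Connects {v} (D k \ {e k i} ∪ {y}) {e k i} := by
    refine ⟨conn_singleton _, ?_, ?_, ⟨_, rfl, v, rfl, hve.symm⟩, ?_⟩
    · rintro z hz hzv
      obtain rfl : z = e k i := hz
      exact H.disjD i k v hv (Set.mem_singleton_iff.1 hzv ▸ H.mem hik.symm)
    · rintro z hz (hzD | hzy)
      · exact hzD.2 hz
      · obtain rfl : z = e k i := hz
        exact H.disjD k k y (hYA hy) (Set.mem_singleton_iff.1 hzy ▸ H.mem hik.symm)
    · obtain ⟨a, -, ha, b, hb, hba, hab⟩ := (H.connD k).exists_adj (T := {e k i})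
        ⟨_, H.mem hik.symm, rfl⟩ ⟨x, hx, hne⟩
      exact ⟨a, ha, b, Or.inl ⟨hb, hba⟩, hab⟩
  have hRA : ∀ z ∈ R, ∀ l, z ∉ A l := fun z hz l hzA => H.disjD l i z hzA (hRD hz)
  have hTA : ∀ z ∈ T, ∀ l, z ∉ A l := fun z hz l hzA => H.disjD l i z hzA (hTD hz)
  have hcon1 : G.Connects {v} (D k \ {e k i} ∪ {y}) (R ∪ Y \ {y}) := by
    refine ⟨?_, ?_, ?_, ⟨r, Or.inl hr, v, rfl, hvr.symm⟩, ?_⟩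
    · rcases hYt with h | ⟨h, hc⟩
      · rw [h, Set.sdiff_self, Set.union_empty]
        exact hR
      · exact hR.union hc ⟨_, heR, p, ⟨hp, h⟩, hep⟩
    · rintro z (hz | hz) hzv
      · exact hRA z hz i (Set.mem_singleton_iff.1 hzv ▸ hv)
      · exact (hvy z (hYA hz.1)).1 (Set.mem_singleton_iff.1 hzv).symm
    · rintro z (hz | hz) (hz' | hz')
      · exact (H.antiD i k hik z (hRD hz) z hz'.1).1 rfl
      · exact hRA z hz k (Set.mem_singleton_iff.1 hz' ▸ hYA hy)
      · exact H.disjD k k z (hYA hz.1) hz'.1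
      · exact hz.2 hz'
    · rcases hYt with h | ⟨h, hc⟩
      · have : p = y := by rw [h] at hp; exact hp
        exact ⟨_, Or.inl heR, y, Or.inr rfl, this ▸ hep⟩
      · obtain ⟨a, -, ha, b, hb, hba, hab⟩ := hY.exists_adj (T := {y}) ⟨_, hy, rfl⟩ ⟨p, hp, h⟩
        exact ⟨b, Or.inr ⟨hb, hba⟩, a, Or.inr ha, hab.symm⟩
  have hcon2 : G.Connects {v} (D k \ {e k i} ∪ {y}) (T ∪ A j) := by
    refine ⟨hT.union (H.connA j) ?_, ?_, ?_, ⟨u, Or.inl hu, v, rfl, hvu.symm⟩, ?_⟩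
    · obtain ⟨a, ha, h⟩ := H.adj hij
      exact ⟨_, heT, a, ha, h⟩
    · rintro z (hz | hz) hzv
      · exact hTA z hz i (Set.mem_singleton_iff.1 hzv ▸ hv)
      · exact (H.antiA i j hij v hv z hz).1 (Set.mem_singleton_iff.1 hzv).symm
    · rintro z (hz | hz) (hz' | hz')
      · exact (H.antiD i k hik z (hTD hz) z hz'.1).1 rfl
      · exact hTA z hz k (Set.mem_singleton_iff.1 hz' ▸ hYA hy)
      · exact H.disjD j k z hz hz'.1
      · exact (H.antiA j k hjk z hz y (hYA hy)).1 hz'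
    · obtain ⟨a, ha, h⟩ := H.adj hjk.symm
      exact ⟨a, Or.inr ha, _, Or.inl ⟨H.mem hjk.symm, hends.1.symm⟩, h.symm⟩
  have h01 : G.Anti {e k i} (R ∪ Y \ {y}) := by
    rintro w hw z (hz | hz)
    · obtain rfl : w = e k i := hw
      exact H.antiD k i hik.symm _ (H.mem hik.symm) z (hRD hz)
    · obtain rfl : w = e k i := hw
      exact ⟨fun h => H.disjD k k z (hYA hz.1) (h ▸ H.mem hik.symm),
        fun h => hz.2 (htu z hz.1 _ (H.mem hik.symm) h.symm)⟩
  have h02 : G.Anti {e k i} (T ∪ A j) := by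
    rintro w hw z (hz | hz)
    · obtain rfl : w = e k i := hw
      exact H.antiD k i hik.symm _ (H.mem hik.symm) z (hTD hz)
    · obtain rfl : w = e k i := hw
      exact ⟨fun h => H.disjD j k z hz (h ▸ H.mem hik.symm),
        fun h => hends.1 (H.uniq hjk.symm hz (H.mem hik.symm) h.symm)⟩
  have h12 : G.Anti (R ∪ Y \ {y}) (T ∪ A j) := by
    rw [anti_union_left, anti_union_right, anti_union_right]
    refine ⟨⟨hRT, anti_of_not_sees (fun z hz => hRA z hz j) fun h => hAR h.symm⟩,
      anti_of_not_sees (fun z hz hzT => hTA z hzT k (hYA hz.1))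
        fun h => hYT (h.mono Set.sdiff_subset subset_rfl),
      (H.antiA k j hjk.symm).mono (Set.sdiff_subset.trans hYA) subset_rfl⟩
  rcases hasConfig_or_isCenter (conn_singleton v) hX' hanti hcon0 hcon1 hcon2 h01 h02 h12 with
    hc | hc | hc | hc
  · exact hc
  -- In a fork at `e k i`, the branch `P` contains `y`, the only attachment of `R ∪ Y \ {y}`. The
  -- other branch reaches `e k j`, so together with `e k i` it exhausts `D k` by minimality; it then
  -- contains `x`, a neighbour of `y`.
  · exfalso
    obtain ⟨w, hw, hF, -⟩ := hc.small_left (small_singleton v)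
    obtain rfl : w = e k i := hw
    obtain ⟨P, Q, hPX, hQX, -, hQ, -, ⟨q, hq, heq⟩, hsP, hsQ, hPQ, -, -⟩ := hF
    have hyP : y ∈ P := by
      obtain ⟨a, ha, b, hb, hab⟩ := hsP
      have hby : b = y := by
        rcases hPX hb with hb' | hb'
        · rcases ha with ha | ha
          · exact absurd hab (H.antiD i k hik a (hRD ha) b hb'.1).2
          · exact absurd (htu a ha.1 b hb'.1 hab) ha.2
        · exact hb'
      exact hby ▸ hb
    have hQD : Q ⊆ D k \ {e k i} := by
      intro z hz
      rcases hQX hz with h | h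
      · exact h
      · exact absurd (Set.mem_singleton_iff.1 h).symm (hPQ y hyP z hz).1
    have heQ : e k j ∈ Q := by
      obtain ⟨a, ha, b, hb, hab⟩ := hsQ
      rcases ha with ha | ha
      · exact absurd hab (H.antiD i k hik a (hTD ha) b (hQD hb).1).2
      · exact H.uniq hjk.symm ha (hQD hb).1 hab ▸ hb
    have hall := hkmin (insert (e k i) Q)
      (Set.insert_subset (H.mem hik.symm) fun z hz => (hQD hz).1) (hQ.cons hq heq) (Or.inl rfl)
      (Or.inr heQ)
    have hxQ : x ∈ Q := by
      rw [← hall] at hx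
      exact hx.resolve_left hne
    exact (hPQ y hyP x hxQ).2 hyx
  · exfalso
    obtain ⟨w, hw, hF, z, hz, hwz⟩ := hc.small_left (small_singleton v)
    obtain rfl : z = v := hz
    rcases hw with hw | hw
    · refine hF.false_of_unique (w := y) fun b hb h => ?_
      rcases hb with hb | hb
      · exact absurd h (H.antiD i k hik w (hRD hw) b hb.1).2
      · exact hb
    · exact (hvy w (hYA hw.1)).2 hwz.symm
  · exfalso
    obtain ⟨w, hw, hF, z, hz, hwz⟩ := hc.small_left (small_singleton v)
    obtain rfl : z = v := hz
    rcases hw with hw | hw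
    · refine hF.false_of_unique (w := y) fun b hb h => ?_
      rcases hb with hb | hb
      · exact absurd h (H.antiD i k hik w (hTD hw) b hb.1).2
      · exact hb
    · exact (H.antiA i j hij z hv w hw).2 hwz.symm

/-- A minimal connected part of `A k` linking the end `e i k` of `D i` to `D k`. -/
theorem exists_link [Finite V] (H : G.MixedModel A D S e) {i k : Fin 3} (hik : i ≠ k) :
    ∃ Y ⊆ A k, ∃ p ∈ Y, ∃ t ∈ Y, G.Conn Y ∧ G.Adj (e i k) p ∧ (∃ x ∈ D k, G.Adj t x) ∧
      (∀ y ∈ Y, ∀ x ∈ D k, G.Adj y x → y = t) ∧ (Y = {t} ∨ (p ≠ t ∧ G.Conn (Y \ {t}))) := by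
  obtain ⟨a, ha, hea⟩ := H.adj hik
  obtain ⟨Y, hYA, ⟨hY, h1, h2⟩, hmin⟩ := exists_minimal_subset
    (P := fun Y => G.Conn Y ∧ (∃ y ∈ Y, y ∈ {y | G.Adj (e i k) y}) ∧
      (∃ y ∈ Y, y ∈ {y | ∃ x ∈ D k, G.Adj y x})) ⟨H.connA k, ⟨a, ha, hea⟩, H.seesD k k⟩
  obtain ⟨p, hp, t, ht, hep, htD, -, htu⟩ := hY.unique_of_minimal h1 h2 hmin
  refine ⟨Y, hYA, p, hp, t, ht, hY, hep, htD, fun y hy x hx h => htu y hy ⟨x, hx, h⟩, ?_⟩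
  by_cases hpt : p = t
  · subst hpt
    exact Or.inl (hmin {p} (by simpa using hp)
      ⟨conn_singleton p, ⟨p, rfl, hep⟩, ⟨p, rfl, htD⟩⟩).symm
  · exact Or.inr ⟨hpt, hY.diff_of_minimal hp ht hpt fun Z hZ hZc hpZ htZ =>
      hmin Z hZ ⟨hZc, ⟨p, hpZ, hep⟩, ⟨t, htZ, htD⟩⟩⟩

/-- Link `D i` to `D k` by minimal links `Z ⊆ A i` and `Y ⊆ A k` and by `A j`. A center in `Z` sees
`D k` only at `e k i`, so it forks in `D i` and turns `Y` into a bridge; a center in `Y` does the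
same for `Z`. Vertices of `A j` have one possible neighbour on each side. -/
theorem exists_bridge [Finite V] (H : G.MixedModel A D S e) (hn : ¬ G.HasConfig) {i k : Fin 3}
    (hik : i ≠ k) : (∃ Y, G.IsEndLink A D e i k Y) ∨ ∃ Y, G.IsEndLink A D e k i Y := by
  obtain ⟨j, hij, hjk⟩ := exists_third hik
  obtain ⟨Y, hYA, p, hp, t, ht, hY, hep, htD, htu, hYt⟩ := H.exists_link hik
  obtain ⟨Z, hZA, q, hq, s, hs, hZ, heq, hsD, hsu, hZs⟩ := H.exists_link hik.symm
  have hYi : G.Sees Y (D i) := ⟨p, hp, _, H.mem hik, hep.symm⟩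
  have hYk : G.Sees Y (D k) := ⟨t, ht, htD⟩
  have hZk : G.Sees Z (D k) := ⟨q, hq, _, H.mem hik.symm, heq.symm⟩
  have hZi : G.Sees Z (D i) := ⟨s, hs, hsD⟩
  rcases hasConfig_or_isCenter (H.connD i) (H.connD k) (H.antiD i k hik)
    (H.connects hZA hZ hZi hZk) (H.connects hYA hY hYi hYk)
    (H.connects subset_rfl (H.connA j) (H.seesD j i) (H.seesD j k))
    ((H.antiA i k hik).mono hZA hYA) ((H.antiA i j hij).mono hZA subset_rfl)
    ((H.antiA k j hjk.symm).mono hYA subset_rfl) with hc | hc | hc | hc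
  · exact absurd hc hn
  · have hu : ∀ v ∈ Z, ∀ y ∈ D k, G.Adj v y → y = e k i := fun v hv y hy h =>
      H.uniq hik.symm (hZA hv) hy h
    obtain ⟨v, hv, ⟨hF, x, hx, hvx⟩ | ⟨hF, -⟩ | ⟨v', hv', -, -, hF⟩⟩ := hc
    · exact Or.inl ⟨Y, H.isEndLink_of_forks hn hij hik hjk hYA hY hp hep ht htD htu hYt (hZA hv)
        (hu v hv x hx hvx ▸ hvx) hF⟩
    · exact (hF.false_of_unique (hu v hv)).elim
    · exact (hF.false_of_unique (hu v' hv')).elim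
  · have hu : ∀ v ∈ Y, ∀ y ∈ D i, G.Adj v y → y = e i k := fun v hv y hy h =>
      H.uniq hik (hYA hv) hy h
    obtain ⟨v, hv, ⟨hF, -⟩ | ⟨hF, x, hx, hvx⟩ | ⟨v', hv', -, hF, -⟩⟩ := hc
    · exact (hF.false_of_unique (hu v hv)).elim
    · exact Or.inr ⟨Z, H.isEndLink_of_forks hn hjk.symm hik.symm hij.symm hZA hZ hq heq hs hsD hsu
        hZs (hYA hv) (hu v hv x hx hvx ▸ hvx) hF⟩
    · exact (hF.false_of_unique (hu v hv)).elim
  · exact absurd hc (not_isCenter_of_unique (fun v hv x hx h => H.uniq hij hv hx h)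
      (fun v hv x hx h => H.uniq hjk.symm hv hx h))

/-- The theta has ends `α ∈ A i` and `β ∈ A j`, which fork in `D i` and `D j` and both see `S`. Its
strands run through `S`, through `Y`, and through `D k`, the last reached by `W` and by a bridge `Z`
for the pair `i`, `k`. -/
theorem hasConfig_of_bridges [Finite V] (H : G.MixedModel A D S e) {i j k : Fin 3} (hij : i ≠ j)
    (hik : i ≠ k) (hjk : j ≠ k) {Y W : Set V} (hY : G.IsEndLink A D e i j Y)
    (hW : G.IsEndLink A D e j k W) : G.HasConfig := by
  by_contra hn
  obtain ⟨α, hα, ⟨Sij, Sik, hSij, hSik, hcij, hcik, hαij, hαik, hsij, hsik, hai, hnij, hnik⟩, hαS⟩ :=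
    H.exists_forks hn hij hik hjk
  obtain ⟨β, hβ, ⟨Sji, Sjk, hSji, hSjk, hcji, hcjk, hβji, hβjk, hsji, hsjk, haj, hnji, hnjk⟩, hβS⟩ :=
    H.exists_forks hn hij.symm hjk hik
  have meij := H.end_mem_of_sees hij subset_rfl hSij hsij
  have meik := H.end_mem_of_sees hik subset_rfl hSik hsik
  have meji := H.end_mem_of_sees hij.symm subset_rfl hSji hsji
  have mejk := H.end_mem_of_sees hjk subset_rfl hSjk hsjk
  have hAD : ∀ {P Q : Set V} {l m : Fin 3}, P ⊆ A l → Q ⊆ D m → ¬ G.Sees P Q → G.Anti P Q := by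
    intro P Q l m hP hQ h
    exact anti_of_not_sees (fun x hx hx' => H.disjD l m x (hP hx) (hQ hx')) h
  -- `Z` may be oriented either way. If it lies in `A i`, it sees `D i` only at `e i k`, which is
  -- outside `Sij`, and it misses `Sji` by `bridge_not_adj_end` for the bridges `Z` and `Y`.
  obtain ⟨Z, hZc, hZik, hZki, hZS, hYZ, hZij, hZji⟩ : ∃ Z, G.Conn Z ∧ (∃ z ∈ Z, G.Adj (e i k) z) ∧
      (∃ z ∈ Z, G.Adj (e k i) z) ∧ G.Anti Z S ∧ G.Anti Y Z ∧ G.Anti Z Sij ∧ G.Anti Z Sji := by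
    rcases H.exists_bridge hn hik with ⟨Z, hZ⟩ | ⟨Z, hZ⟩
    · refine ⟨Z, hZ.conn, hZ.adj, ?_, anti_of_not_sees (fun x hx => H.disjS k x (hZ.sub hx))
        (H.bridge_not_sees_small hn hik hZ), (H.antiA j k hjk).mono hY.sub hZ.sub,
        hAD hZ.sub hSij fun h => hnij (h.mono hZ.sub subset_rfl),
        hAD hZ.sub hSji fun h => hnji (h.mono hZ.sub subset_rfl)⟩
      obtain ⟨z, hz, x, hx, h⟩ := hZ.sees
      exact ⟨z, hz, hZ.uniq z hz x hx h ▸ h.symm⟩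
    · refine ⟨Z, hZ.conn, ?_, hZ.adj, anti_of_not_sees (fun x hx => H.disjS i x (hZ.sub hx))
        (H.bridge_not_sees_small hn hik.symm hZ), (H.antiA j i hij.symm).mono hY.sub hZ.sub,
        hAD hZ.sub hSij ?_, hAD hZ.sub hSji ?_⟩
      · obtain ⟨z, hz, x, hx, h⟩ := hZ.sees
        exact ⟨z, hz, hZ.uniq z hz x hx h ▸ h.symm⟩
      · rintro ⟨z, hz, x, hx, h⟩
        have := hZ.uniq z hz x (hSij hx) h
        exact (hai x hx _ meik).1 this
      · rintro ⟨z, hz, x, hx, h⟩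
        refine H.bridge_not_adj_end hn hik.symm hjk.symm hij hZ hY z hz ?_
        exact H.uniq hij.symm (hZ.sub hz) (hSji hx) h ▸ h
  have hYS : G.Anti Y S := anti_of_not_sees (fun x hx => H.disjS j x (hY.sub hx))
    (H.bridge_not_sees_small hn hij hY)
  have hWS : G.Anti W S := anti_of_not_sees (fun x hx => H.disjS k x (hW.sub hx))
    (H.bridge_not_sees_small hn hjk hW)
  have hYjk : G.Anti Y Sjk := hAD hY.sub hSjk (by
    rintro ⟨y, hy, x, hx, h⟩
    exact (haj _ meji x hx).1 (hY.uniq y hy x (hSjk hx) h).symm)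
  have hYk : G.Anti Y (D k) := hAD hY.sub subset_rfl (by
    rintro ⟨y, hy, x, hx, h⟩
    exact H.bridge_not_adj_end hn hij hik hjk hY hW y hy (H.uniq hjk.symm (hY.sub hy) hx h ▸ h))
  have hN1 : G.Conn (Sij ∪ Y ∪ Sji) := by
    obtain ⟨y, hy, h⟩ := hY.adj
    obtain ⟨z, hz, x, hx, h'⟩ := hY.sees
    exact (hcij.union hY.conn ⟨_, meij, y, hy, h⟩).union hcji
      ⟨z, Or.inr hz, _, meji, hY.uniq z hz x hx h' ▸ h'⟩
  have hN2 : G.Conn (Sik ∪ Z ∪ D k ∪ (W ∪ Sjk)) := by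
    obtain ⟨z, hz, h⟩ := hZik
    obtain ⟨z', hz', h'⟩ := hZki
    obtain ⟨w, hw, hw'⟩ := hW.adj
    refine ((hcik.union hZc ⟨_, meik, z, hz, h⟩).union (H.connD k)
      ⟨z', Or.inr hz', _, H.mem hik.symm, h'.symm⟩).union
      (hW.conn.union hcjk ⟨w, hw, _, mejk, hw'.symm⟩) ?_
    exact hW.sees.symm.mono Set.subset_union_right Set.subset_union_left
  have h01 : G.Anti S (Sij ∪ Y ∪ Sji) := by
    simp only [anti_union_right]
    exact ⟨⟨(H.antiS i).mono subset_rfl hSij, hYS.symm⟩, (H.antiS j).mono subset_rfl hSji⟩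
  have h02 : G.Anti S (Sik ∪ Z ∪ D k ∪ (W ∪ Sjk)) := by
    simp only [anti_union_right]
    exact ⟨⟨⟨(H.antiS i).mono subset_rfl hSik, hZS.symm⟩, H.antiS k⟩, hWS.symm,
      (H.antiS j).mono subset_rfl hSjk⟩
  have h12 : G.Anti (Sij ∪ Y ∪ Sji) (Sik ∪ Z ∪ D k ∪ (W ∪ Sjk)) := by
    simp only [anti_union_left, anti_union_right]
    have hZij := hZij.symm
    have hZji := hZji.symm
    have h1 := (H.antiD i k hik).mono hSij subset_rfl
    have h2 := (H.antiD i j hij).mono hSij hSjk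
    have h3 := hAD hY.sub hSik fun h => hnik (h.mono hY.sub subset_rfl)
    have h4 := (H.antiA j k hjk).mono hY.sub hW.sub
    have h5 := (H.antiD j i hij.symm).mono hSji hSik
    have h6 := (H.antiD j k hjk).mono hSji subset_rfl
    have h7 := (hAD hW.sub hSij fun h => hnij (h.mono hW.sub subset_rfl)).symm
    have h8 := (hAD hW.sub hSji fun h => hnji (h.mono hW.sub subset_rfl)).symm
    split_ands <;> assumption
  obtain ⟨N, hN0, hN1', hN2'⟩ := exists_fun3 (show (0 : Fin 3) ≠ 1 by decide)
    (show (0 : Fin 3) ≠ 2 by decide) (show (1 : Fin 3) ≠ 2 by decide)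
    S (Sij ∪ Y ∪ Sji) (Sik ∪ Z ∪ D k ∪ (W ∪ Sjk))
  have hN : ∀ l, G.Conn (N l) ∧ (∃ x ∈ N l, G.Adj α x) ∧ ∃ x ∈ N l, G.Adj β x := by
    refine forall3 (show (0 : Fin 3) ≠ 1 by decide)
      (show (0 : Fin 3) ≠ 2 by decide) (show (1 : Fin 3) ≠ 2 by decide) ?_ ?_ ?_
    · rw [hN0]
      exact ⟨H.connS, hαS, hβS⟩
    · rw [hN1']
      obtain ⟨x, hx, h⟩ := hαij
      obtain ⟨y, hy, h'⟩ := hβji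
      exact ⟨hN1, ⟨x, Or.inl (Or.inl hx), h⟩, y, Or.inr hy, h'⟩
    · rw [hN2']
      obtain ⟨x, hx, h⟩ := hαik
      obtain ⟨y, hy, h'⟩ := hβjk
      exact ⟨hN2, ⟨x, Or.inl (Or.inl (Or.inl hx)), h⟩, y, Or.inr (Or.inr hy), h'⟩
  have hNN : ∀ l m, l ≠ m → G.Anti (N l) (N m) :=
    forall3_pair (show (0 : Fin 3) ≠ 1 by decide) (show (0 : Fin 3) ≠ 2 by decide)
      (show (1 : Fin 3) ≠ 2 by decide) (fun _ _ h => h.symm) (by rwa [hN0, hN1'])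
      (by rwa [hN0, hN2']) (by rwa [hN1', hN2'])
  have hαβ := H.antiA i j hij α hα β hβ
  refine hn (hasConfig_of_theta (a := α) (b := β) (F := fun l => insert α (insert β (N l)))
    hαβ.1 hαβ.2 (fun l => ?_) (fun l => Or.inl rfl) (fun l => Or.inr (Or.inl rfl)) ?_)
  · obtain ⟨h1, ⟨x, hx, h2⟩, y, hy, h3⟩ := hN l
    exact (h1.cons hy h3).cons (Or.inr hx) h2
  · intro l m hlm x hx y hy hxα hxβ hyα hyβ
    exact hNN l m hlm x ((hx.resolve_left hxα).resolve_left hxβ) y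
      ((hy.resolve_left hyα).resolve_left hyβ)

/-- Each of the eight orientations of the three pairs contains two consecutive arcs `i → j → k`. -/
theorem hasConfig [Finite V] (H : G.MixedModel A D S e) : G.HasConfig := by
  by_contra hn
  have h01 : (0 : Fin 3) ≠ 1 := by decide
  have h02 : (0 : Fin 3) ≠ 2 := by decide
  have h12 : (1 : Fin 3) ≠ 2 := by decide
  have key : ∀ {i j k : Fin 3}, i ≠ j → i ≠ k → j ≠ k → (∃ Y, G.IsEndLink A D e i j Y) →
      (∃ Y, G.IsEndLink A D e j k Y) → False := by
    rintro i j k hij hik hjk ⟨Y, hY⟩ ⟨W, hW⟩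
    exact hn (H.hasConfig_of_bridges hij hik hjk hY hW)
  rcases H.exists_bridge hn h01 with a | a <;> rcases H.exists_bridge hn h02 with b | b <;>
    rcases H.exists_bridge hn h12 with c | c
  · exact key h01 h02 h12 a c
  · exact key h02 h01 h12.symm b c
  · exact key h01 h02 h12 a c
  · exact key h02.symm h12.symm h01 b a
  · exact key h01.symm h12 h02 a b
  · exact key h01.symm h12 h02 a b
  · exact key h12 h01.symm h02.symm c b
  · exact key h12.symm h02.symm h01.symm c a

end MixedModel

/-! ### Conclusion: counting small sets and kinds -/

theorem exists_fourth (a b j : Fin 4) : ∃ c, a ≠ c ∧ b ≠ c ∧ c ≠ j := by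
  revert a b j
  decide

theorem MinModel.hasConfig [Finite V] {A : Fin 3 → Set V} {B : Fin 4 → Set V}
    (h : G.MinModel A B) : G.HasConfig := by
  by_cases hsm : ∃ j, G.Small (B j)
  · obtain ⟨j, hj⟩ := hsm
    by_cases hl : ∀ l, l ≠ j → ¬ G.Small (B l)
    · have hlarge : ∀ l : {l // l ≠ j}, ∃ f e, G.Large A (B l) f e := fun l =>
        (h.small_or_large l).resolve_left (hl l l.2)
      choose f e hfe using hlarge
      by_cases hinj : Function.Injective f
      -- Three large sets with distinct kinds realise every kind, so `σ` relabels them by their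
      -- kinds.
      · have hcard : Fintype.card {l // l ≠ j} = Fintype.card (Fin 3) := by simp
        have hsurj := ((Fintype.bijective_iff_injective_and_card f).2 ⟨hinj, hcard⟩).2
        choose σ hσ using hsurj
        have hσne : ∀ i k, i ≠ k → (σ i : Fin 4) ≠ σ k := by
          intro i k hik hs
          exact hik (by rw [← hσ i, ← hσ k, Subtype.ext hs])
        have H : G.MixedModel A (fun i => B (σ i)) (B j) (fun i => e (σ i)) :=
          ⟨h.connA, fun i => h.connB _, h.connB j, h.antiA, fun i k hik => h.antiB _ _ (hσne i k hik),
            fun i => h.antiB _ _ (σ i).2.symm, fun i k => h.disj _ _, fun i => h.disj _ _,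
            fun i k => h.sees _ _, fun i => h.sees _ _, hj,
            fun i => by simpa only [hσ] using hfe (σ i)⟩
        exact H.hasConfig
      · simp only [Function.Injective] at hinj
        push Not at hinj
        obtain ⟨a, b, hab, hne⟩ := hinj
        have hne' : (a : Fin 4) ≠ b := fun h => hne (Subtype.ext h)
        obtain ⟨c, hca, hcb, hcj⟩ : ∃ c : Fin 4, (a : Fin 4) ≠ c ∧ (b : Fin 4) ≠ c ∧ c ≠ j := exists_fourth _ _ _
        exact h.hasConfig_of_same hne' hca hcb (hfe a) (hab ▸ hfe b) (hfe ⟨c, hcj⟩)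
    · push Not at hl
      obtain ⟨l, hlj, hl⟩ := hl
      exact h.hasConfig_of_small_small hlj hl hj
  · push Not at hsm
    have hlarge : ∀ l, ∃ f e, G.Large A (B l) f e := fun l =>
      (h.small_or_large l).resolve_left (hsm l)
    choose f e hfe using hlarge
    obtain ⟨a, b, hne, hab⟩ := Fintype.exists_ne_map_eq_of_card_lt f (by simp)
    obtain ⟨c, hca, hcb, -⟩ := exists_fourth a b b
    exact h.hasConfig_of_same hne hca hcb (hfe a) (hab ▸ hfe b) (hfe c)

end SimpleGraph

theorem theorem3 {V : Type*} [Finite V] (G : SimpleGraph V)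
    (hG : SimpleGraph.IsInducedMinor (completeBipartiteGraph (Fin 3) (Fin 4)) G) :
    ∃ S : Set V, (G.induce S).IsThreePathConfiguration := by
  obtain ⟨A, B, h⟩ := hG.exists_model
  obtain ⟨A, B, h⟩ := h.exists_minModel
  exact h.hasConfig
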